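/- Graphs are simple and locally finite. A connected graph is called transient (resp. recurrent) if the simple random walk on it is transient (resp. recurrent). For an infinite connected graph $G$ and $p\in[0,1]$ let $\mathbb{P}_p$ be the law of Bernoulli bond percolation on $G$ (each edge is open with probability $p$, independently), let $C_x$ be the open cluster of the vertex $x$ (with its open edges), and let $p_c(G)=\inf\{p\in(0,1):\mathbb{P}_p(|C_x|=\infty)>0\}$ (with $\inf\emptyset=1$), which does not depend on $x$. For a subgraph $H$ of $G$ let $\mathcal{U}(H)$ be the random subgraph with $$V(\mathcal{U}(H))=\bigcup_{x\in V(H)}V(C_x),\qquad E(\mathcal{U}(H))=E(H)\cup\bigcup_{x\in V(H)}E(C_x),$$ and, $\mathcal{P}$ being the property of being a (connected) transient subgraph, let $$p_{c,1}(G,H,\mathcal{P})=\inf\{p\in[0,1]:\mathbb{P}_p(\mathcal{U}(H)\in\mathcal{P})>0\},\qquad p_{c,2}(G,H,\mathcal{P})=\inf\{p\in[0,1]:\mathbb{P}_p(\mathcal{U}(H)\in\mathcal{P})=1\}.$$ **Theorem.** (i) There is a transient, locally finite tree $T$ with $p_c(T)=1$ and a vertex $r$ of $T$ such that the graph $G$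 obtained from the square lattice $\mathbb{Z}^2$ and $T$ by identifying the origin of $\mathbb{Z}^2$ with $r$ is a connected, locally finite, transient graph, and for every connected recurrent subgraph $H$ of $G$ $$0<p_c(G)<p_{c,1}(G,H,\mathcal{P})=1.$$ (ii) There is a strictly increasing sequence of positive integers $(m_k)_{k\ge 0}$ such that the graph $G$ obtained from the half-line multigraph on $\{0,1,2,\dots\}$ with $m_k$ parallel edges between $k$ and $k+1$ (and no other edges), by placing a new vertex in the middle of every edge, is a connected, locally finite, transient graph, and for every infinite connected recurrent subgraph $H$ of $G$ $$p_{c,2}(G,H,\mathcal{P})=0.$$ -/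

import Mathlib

open MeasureTheory ProbabilityTheory Set unitInterval
open scoped ENNReal

noncomputable section

namespace PercEnlarge

variable {V : Type*}

/-- Every vertex has finitely many neighbours. -/
def LocFinite (G : SimpleGraph V) : Prop := ∀ v, (G.neighborSet v).Finite

/-! ### Simple random walk, transience and recurrence -/

open Classical in
/-- One-step transition probabilities of the simple random walk: jump to a uniformly chosen
neighbour. At an isolated vertex (in a connected graph: the one-point graph) the walk stays put. -/
def stepProb (G : SimpleGraph V) (x y : V) : ℝ≥0∞ :=
  if G.neighborSet x = ∅ then (if x = y then 1 else 0)
  else if G.Adj x y then ((G.neighborSet x).encard : ℝ≥0∞)⁻¹ else 0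

open Classical in
/-- `P^x(S_n = y)` for the simple random walk `S` on `G`. -/
def walkProb (G : SimpleGraph V) : ℕ → V → V → ℝ≥0∞
  | 0, x, y => if x = y then 1 else 0
  | n + 1, x, y => ∑' z, stepProb G x z * walkProb G n z y

/-- The Green function: the expected number of visits to `y` of the walk started at `x`. -/
def green (G : SimpleGraph V) (x y : V) : ℝ≥0∞ := ∑' n, walkProb G n x y

/-- A connected graph is transient if the expected number of returns of the simple random walk
to its starting point is finite. (`SimpleGraph.Connected` includes non-emptiness.) -/
def IsTransient (G : SimpleGraph V) : Prop := G.Connected ∧ ∀ x, green G x x < ∞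

/-- A connected graph is recurrent if the expected number of returns of the simple random walk
to its starting point is infinite. -/
def IsRecurrent (G : SimpleGraph V) : Prop := G.Connected ∧ ∀ x, green G x x = ∞

/-- The property (set of subgraphs of `G`) of being a transient subgraph. -/
def transientSubgraphs (G : SimpleGraph V) : Set G.Subgraph := {X | IsTransient X.coe}

/-! ### Bernoulli bond percolation -/

/-- The Bernoulli measure `ℙ_p` on configurations, a configuration being identified with its set
of open edges: each edge of `G` is open with probability `p`, independently. -/
def percMeasure (G : SimpleGraph V) (p : I) : Measure (Set (Sym2 V)) := setBernoulli G.edgeSet p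

/-- The spanning subgraph formed by the open edges of `G`. -/
def openGraph (G : SimpleGraph V) (ω : Set (Sym2 V)) : SimpleGraph V where
  Adj u v := G.Adj u v ∧ s(u, v) ∈ ω
  symm := ⟨fun u v h => ⟨h.1.symm, by rw [Sym2.eq_swap]; exact h.2⟩⟩
  loopless := ⟨fun v h => G.loopless.irrefl v h.1⟩

/-- The vertex set of the open cluster `C_x`. -/
def cluster (G : SimpleGraph V) (ω : Set (Sym2 V)) (x : V) : Set V :=
  {y | (openGraph G ω).Reachable x y}

/-- Hammersley's critical probability, as seen from the vertex `x` (for a connected graph it does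
not depend on `x`). The infimum is taken in `[0, 1]`, so that it is `1` for the empty set. -/
def pc (G : SimpleGraph V) (x : V) : I :=
  sInf {p : I | p ∈ Ioo (0 : I) 1 ∧ 0 < percMeasure G p {ω | (cluster G ω x).Infinite}}

/-- The enlargement `U_ω(H)`: the union of `H` and of the open clusters (with their open edges)
of all vertices of `H`. -/
def enlarge {G : SimpleGraph V} (ω : Set (Sym2 V)) (H : G.Subgraph) : G.Subgraph where
  verts := ⋃ x ∈ H.verts, cluster G ω x
  Adj u v := H.Adj u v ∨ ∃ x ∈ H.verts, u ∈ cluster G ω x ∧ v ∈ cluster G ω x ∧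
    (openGraph G ω).Adj u v
  adj_sub := by
    rintro u v (h | ⟨_, _, _, _, h⟩)
    · exact h.adj_sub
    · exact h.1
  edge_vert := by
    rintro u v (h | ⟨x, hx, hu, _, _⟩)
    · exact mem_biUnion h.fst_mem (SimpleGraph.Reachable.refl u)
    · exact mem_biUnion hx hu
  symm := by
    refine ⟨?_⟩
    rintro u v (h | ⟨x, hx, hu, hv, h⟩)
    · exact Or.inl h.symm
    · exact Or.inr ⟨x, hx, hv, hu, h.symm⟩

/-- `p_{c,1}(G, H, 𝒫)`: the infimum of the `p ∈ [0, 1]` such that `U(H)` has the property `𝒫` with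
positive probability. -/
def pc1 (G : SimpleGraph V) (H : G.Subgraph) (P : Set G.Subgraph) : I :=
  sInf {p : I | 0 < percMeasure G p {ω | enlarge ω H ∈ P}}

/-- `p_{c,2}(G, H, 𝒫)`: the infimum of the `p ∈ [0, 1]` such that `U(H)` has the property `𝒫` with
probability one. -/
def pc2 (G : SimpleGraph V) (H : G.Subgraph) (P : Set G.Subgraph) : I :=
  sInf {p : I | ∀ᵐ ω ∂percMeasure G p, enlarge ω H ∈ P}

/-! ### The graphs -/

/-- The nearest-neighbour square lattice `ℤ²`. -/
def squareLattice : SimpleGraph (ℤ × ℤ) where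
  Adj x y := |x.1 - y.1| + |x.2 - y.2| = 1
  symm := ⟨fun x y h => by rw [abs_sub_comm y.1, abs_sub_comm y.2]; exact h⟩
  loopless := ⟨fun x h => by simp at h⟩

/-- The graph obtained from disjoint copies of `A` and `B` by identifying the vertex `a` of `A`
with the vertex `b` of `B`, realised as the union of the copies `A × {b}` and `{a} × B` in the
Cartesian product of `A` and `B`. -/
def attach {α β : Type*} (A : SimpleGraph α) (a : α) (B : SimpleGraph β) (b : β) :
    SimpleGraph {q : α × β // q.1 = a ∨ q.2 = b} where
  Adj q q' := (A.Adj q.1.1 q'.1.1 ∧ q.1.2 = b ∧ q'.1.2 = b) ∨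
    (B.Adj q.1.2 q'.1.2 ∧ q.1.1 = a ∧ q'.1.1 = a)
  symm := by
    refine ⟨?_⟩
    rintro q q' (⟨h, h1, h2⟩ | ⟨h, h1, h2⟩)
    · exact Or.inl ⟨h.symm, h2, h1⟩
    · exact Or.inr ⟨h.symm, h2, h1⟩
  loopless := by
    refine ⟨?_⟩
    rintro q (⟨h, _⟩ | ⟨h, _⟩)
    · exact A.loopless.irrefl _ h
    · exact B.loopless.irrefl _ h

/-- The half-line `0, 1, 2, …` with `m k` parallel edges between `k` and `k + 1`, made simple by
a new vertex in the middle of each edge: `Sum.inr ⟨k, i⟩` is the middle of the `i`-th edge between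
`k` and `k + 1`, and is joined to `Sum.inl k` and `Sum.inl (k + 1)`. -/
def multiLine (m : ℕ → ℕ) : SimpleGraph (ℕ ⊕ (Σ k : ℕ, Fin (m k))) :=
  SimpleGraph.fromRel fun u v =>
    ∃ (k : ℕ) (i : Fin (m k)), (u = Sum.inl k ∨ u = Sum.inl (k + 1)) ∧ v = Sum.inr ⟨k, i⟩

end PercEnlarge

end

noncomputable section

namespace PercEnlarge

variable {V : Type*}

/-! ### Dirichlet energy and transience -/

/-! Transience is handled through capacity. A vertex `x` has positive capacity when `f x ^ 2 ≤ c *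
energy f` for all finitely supported `f`, and `green_lt_top_iff` shows that this is equivalent to a
finite Green function at `x`. The criterion passes from a graph to any graph containing it, and
recurrence becomes the existence of finitely supported functions with value 1 at `x` and arbitrarily
small energy. All walks are treated by exhibiting or excluding such functions.

(i) The tree is spherically symmetric with about `n ^ 4` vertices at level `n`. The level averages
of `f` change by at most a constant times `√E / n ^ 2` at step `n`, `E` being the energy of `f`,
which is summable, so the tree is transient (`polyTree_capPos`). But `n ^ 4 * q ^ n → 0` for `q <
1`, so percolation on it has only finite clusters below `p = 1`
(`polyTree_measure_cluster_infinite`). The glued graph has bounded degree, which gives `0 < pc`, and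
the lattice supplies an infinite cluster for `p` near 1 by Peierls' argument, which gives `pc < 1`.
For `p < 1`, the enlargement of a recurrent `H` consists of lattice edges, the tree edges of `H`,
and finite bushes of other open tree edges. Tree edges are bridges and `H` is connected, so a bush
meets `H` in at most one vertex. A cheap test function for `H` thus extends constantly along bushes
at no cost and is continued over the recurrent lattice by a multiple of a cheap lattice function.
The enlargement is therefore never transient (`not_isTransient_enlarge`).

(ii) Take `m k = 4 ^ k` and split these edges into `2 ^ k` groups of `2 ^ k`. For `p > 0` the
probability that some group has no fully open edge is at most `2 ^ k * (1 - p ^ 2) ^ (2 ^ k)`, which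
is summable. By Borel–Cantelli, almost surely at least `2 ^ k` open connections join `k` to `k + 1`
for all large `k`. An infinite connected `H` contains all large `k`, so its enlargement contains a
half-line with exponentially growing multiplicities, which is transient (`capPos_of_multiple_line`).
-/

open Classical in
/-- The Dirichlet energy of `f`, every edge being counted in both directions. -/
def energy (G : SimpleGraph V) (f : V → ℝ) : ℝ≥0∞ :=
  ∑' e : V × V, if G.Adj e.1 e.2 then ENNReal.ofReal ((f e.1 - f e.2) ^ 2) else 0

/-- The vertex `x` has positive capacity: finitely supported functions are bounded at `x` by
their energy. -/
def CapPos (G : SimpleGraph V) (x : V) : Prop :=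
  ∃ c : NNReal, ∀ f : V → ℝ, f.support.Finite → ENNReal.ofReal (f x ^ 2) ≤ c * energy G f

/-- The finite set `S` contains the support of `f` and all neighbours of the support. -/
def Covers (G : SimpleGraph V) (S : Finset V) (f : V → ℝ) : Prop :=
  ∀ x, f x ≠ 0 → x ∈ S ∧ ∀ y, G.Adj x y → y ∈ S

lemma Covers.mono {G : SimpleGraph V} {S S' : Finset V} {f : V → ℝ} (h : Covers G S f)
    (hS : S ⊆ S') : Covers G S' f :=
  fun x hx => ⟨hS (h x hx).1, fun y hy => hS ((h x hx).2 y hy)⟩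

lemma exists_covers {G : SimpleGraph V} (hG : LocFinite G) {f : V → ℝ} (hf : f.support.Finite) :
    ∃ S, Covers G S f := by
  classical
  refine ⟨hf.toFinset ∪ hf.toFinset.biUnion fun x => (hG x).toFinset, fun x hx => ⟨?_, ?_⟩⟩
  · simp [hx]
  · intro y hy
    simp only [Finset.mem_union, Finset.mem_biUnion, Finite.mem_toFinset]
    exact Or.inr ⟨x, hx, hy⟩

open Classical in
/-- The Dirichlet form restricted to a finite set of vertices. -/
def dirForm (G : SimpleGraph V) (S : Finset V) (f g : V → ℝ) : ℝ :=
  ∑ x ∈ S, ∑ y ∈ S, if G.Adj x y then (f x - f y) * (g x - g y) else 0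

lemma dirForm_comm (G : SimpleGraph V) (S : Finset V) (f g : V → ℝ) :
    dirForm G S f g = dirForm G S g f := by
  simp only [dirForm, mul_comm]

/-- An edge on which `f` is not constant has an end in the support, so both of its ends lie in the
covering set. -/
lemma energy_eq_dirForm {G : SimpleGraph V} {S : Finset V} {f : V → ℝ} (h : Covers G S f) :
    energy G f = ENNReal.ofReal (dirForm G S f f) := by
  classical
  rw [energy, dirForm, ← Finset.sum_product', ENNReal.ofReal_sum_of_nonneg]
  · rw [tsum_eq_sum (s := S ×ˢ S)]
    · refine Finset.sum_congr rfl fun e _ => ?_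
      split_ifs <;> simp [sq]
    · intro e he
      split_ifs with ha
      · have : f e.1 = 0 ∧ f e.2 = 0 := by
          refine ⟨?_, ?_⟩
          · by_contra hne
            exact he (Finset.mem_product.2 ⟨(h _ hne).1, (h _ hne).2 _ ha⟩)
          · by_contra hne
            exact he (Finset.mem_product.2 ⟨(h _ hne).2 _ ha.symm, (h _ hne).1⟩)
        simp [this.1, this.2]
      · rfl
  · intro e _
    split_ifs
    · exact mul_self_nonneg _
    · exact le_rfl

lemma dirForm_self_nonneg (G : SimpleGraph V) (S : Finset V) (f : V → ℝ) :
    0 ≤ dirForm G S f f := by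
  refine Finset.sum_nonneg fun x _ => Finset.sum_nonneg fun y _ => ?_
  split_ifs
  · exact mul_self_nonneg _
  · exact le_rfl

lemma dirForm_sq_le (G : SimpleGraph V) (S : Finset V) (f g : V → ℝ) :
    dirForm G S f g ^ 2 ≤ dirForm G S f f * dirForm G S g g := by
  classical
  have key : ∀ f g : V → ℝ, dirForm G S f g = ∑ e ∈ S ×ˢ S,
      (if G.Adj e.1 e.2 then f e.1 - f e.2 else 0) *
      (if G.Adj e.1 e.2 then g e.1 - g e.2 else 0) := by
    intro f g
    rw [dirForm, ← Finset.sum_product']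
    refine Finset.sum_congr rfl fun e _ => ?_
    split_ifs <;> simp
  rw [key f g, key f f, key g g]
  refine (Finset.sum_mul_sq_le_sq_mul_sq _ _ _).trans (le_of_eq ?_)
  simp only [sq]

/-- The neighbours of `x` as a finite set. -/
def nbrs {G : SimpleGraph V} (hG : LocFinite G) (x : V) : Finset V := (hG x).toFinset

lemma mem_nbrs {G : SimpleGraph V} (hG : LocFinite G) {x y : V} :
    y ∈ nbrs hG x ↔ G.Adj x y := by simp [nbrs]

/-- Summation by parts. The factor 2 appears because each edge is counted in both directions; only
`f` needs to be covered, so `g` may be arbitrary. -/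
lemma dirForm_eq {G : SimpleGraph V} (hG : LocFinite G) {S : Finset V} {f : V → ℝ}
    (h : Covers G S f) (g : V → ℝ) :
    dirForm G S f g =
      2 * ∑ x ∈ S, f x * ((nbrs hG x).card * g x - ∑ y ∈ nbrs hG x, g y) := by
  classical
  have h1 : ∀ x, f x ≠ 0 → S.filter (fun y => G.Adj x y) = nbrs hG x := by
    intro x hx
    ext y
    simp only [Finset.mem_filter, mem_nbrs]
    exact ⟨fun h => h.2, fun hy => ⟨(h x hx).2 y hy, hy⟩⟩
  have h2 : ∑ x ∈ S, ∑ y ∈ S, (if G.Adj x y then f x * (g x - g y) else 0) =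
      ∑ x ∈ S, f x * ((nbrs hG x).card * g x - ∑ y ∈ nbrs hG x, g y) := by
    refine Finset.sum_congr rfl fun x _ => ?_
    by_cases hx : f x = 0
    · simp [hx]
    · rw [← Finset.sum_filter, h1 x hx, ← Finset.mul_sum, Finset.sum_sub_distrib]
      simp
  have h3 : ∑ x ∈ S, ∑ y ∈ S, (if G.Adj x y then f y * (g y - g x) else 0) =
      ∑ x ∈ S, ∑ y ∈ S, (if G.Adj x y then f x * (g x - g y) else 0) := by
    rw [Finset.sum_comm]
    simp only [G.adj_comm]
  rw [← h2, two_mul]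
  nth_rw 1 [← h3]
  simp only [dirForm, ← Finset.sum_add_distrib]
  refine Finset.sum_congr rfl fun x _ => Finset.sum_congr rfl fun y _ => ?_
  split_ifs <;> ring

/-! ### Return probabilities as real numbers -/

/-- `P^x(S_n = o)` as a real number. -/
def hitProb (G : SimpleGraph V) (o : V) (n : ℕ) (x : V) : ℝ := (walkProb G n x o).toReal

lemma stepProb_eq {G : SimpleGraph V} (hG : LocFinite G) {x : V} (hx : (G.neighborSet x).Nonempty)
    (y : V) [Decidable (y ∈ nbrs hG x)] :
    stepProb G x y = if y ∈ nbrs hG x then ((nbrs hG x).card : ℝ≥0∞)⁻¹ else 0 := by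
  classical
  rw [stepProb, if_neg hx.ne_empty]
  have : (G.neighborSet x).encard = (nbrs hG x).card := by
    rw [← Set.encard_coe_eq_coe_finsetCard]; simp [nbrs]
  rw [this]
  simp [mem_nbrs]

lemma walkProb_succ {G : SimpleGraph V} (hG : LocFinite G) {x : V}
    (hx : (G.neighborSet x).Nonempty) (n : ℕ) (o : V) :
    walkProb G (n + 1) x o = ∑ z ∈ nbrs hG x, ((nbrs hG x).card : ℝ≥0∞)⁻¹ * walkProb G n z o := by
  classical
  rw [walkProb, tsum_eq_sum (s := nbrs hG x)]
  · refine Finset.sum_congr rfl fun z hz => ?_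
    rw [stepProb_eq hG hx, if_pos hz]
  · intro z hz
    rw [stepProb_eq hG hx, if_neg hz, zero_mul]

lemma nbrs_card_pos {G : SimpleGraph V} (hG : LocFinite G) {x : V}
    (hx : (G.neighborSet x).Nonempty) : 0 < (nbrs hG x).card := by
  obtain ⟨y, hy⟩ := hx
  exact Finset.card_pos.2 ⟨y, (mem_nbrs hG).2 hy⟩

lemma walkProb_ne_top {G : SimpleGraph V} (hG : LocFinite G)
    (hN : ∀ x, (G.neighborSet x).Nonempty) (n : ℕ) (x o : V) : walkProb G n x o ≠ ∞ := by
  induction n generalizing x with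
  | zero => rw [walkProb]; split_ifs <;> simp
  | succ n ih =>
    rw [walkProb_succ hG (hN x)]
    refine ENNReal.sum_ne_top.2 fun z _ => ENNReal.mul_ne_top ?_ (ih z)
    simpa using (nbrs_card_pos hG (hN x)).ne'

lemma hitProb_zero (G : SimpleGraph V) (o x : V) [Decidable (x = o)] :
    hitProb G o 0 x = if x = o then 1 else 0 := by
  rw [hitProb, walkProb]; split_ifs <;> simp

lemma hitProb_nonneg (G : SimpleGraph V) (o : V) (n : ℕ) (x : V) : 0 ≤ hitProb G o n x :=
  ENNReal.toReal_nonneg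

lemma card_mul_hitProb_succ {G : SimpleGraph V} (hG : LocFinite G)
    (hN : ∀ x, (G.neighborSet x).Nonempty) (o : V) (n : ℕ) (x : V) :
    (nbrs hG x).card * hitProb G o (n + 1) x = ∑ y ∈ nbrs hG x, hitProb G o n y := by
  have h0 : ((nbrs hG x).card : ℝ) ≠ 0 := by
    exact_mod_cast (nbrs_card_pos hG (hN x)).ne'
  rw [hitProb, walkProb_succ hG (hN x), ENNReal.toReal_sum, Finset.mul_sum]
  · refine Finset.sum_congr rfl fun z _ => ?_
    rw [ENNReal.toReal_mul, ENNReal.toReal_inv, hitProb]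
    simp [h0]
  · intro z _
    refine ENNReal.mul_ne_top ?_ (walkProb_ne_top hG hN _ _ _)
    simpa using (nbrs_card_pos hG (hN x)).ne'

lemma hitProb_support_finite {G : SimpleGraph V} (hG : LocFinite G)
    (hN : ∀ x, (G.neighborSet x).Nonempty) (o : V) (n : ℕ) :
    (hitProb G o n).support.Finite := by
  classical
  induction n with
  | zero =>
    refine (Set.finite_singleton o).subset fun x hx => ?_
    by_contra h
    exact hx (by rw [hitProb_zero, if_neg (by simpa using h)])
  | succ n ih =>
    refine (ih.biUnion fun y _ => hG y).subset fun x hx => ?_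
    have h1 : ∑ y ∈ nbrs hG x, hitProb G o n y ≠ 0 := by
      rw [← card_mul_hitProb_succ hG hN]
      exact mul_ne_zero (by exact_mod_cast (nbrs_card_pos hG (hN x)).ne') hx
    obtain ⟨y, hy, hne⟩ := Finset.exists_ne_zero_of_sum_ne_zero h1
    exact mem_biUnion (show y ∈ _ from hne) ((mem_nbrs hG).1 hy).symm

/-- The truncated Green function. -/
def truncGreen (G : SimpleGraph V) (o : V) (n : ℕ) (x : V) : ℝ :=
  ∑ k ∈ Finset.range n, hitProb G o k x

lemma truncGreen_nonneg (G : SimpleGraph V) (o : V) (n : ℕ) (x : V) : 0 ≤ truncGreen G o n x :=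
  Finset.sum_nonneg fun _ _ => hitProb_nonneg _ _ _ _

lemma exists_covers_hitProb {G : SimpleGraph V} (hG : LocFinite G)
    (hN : ∀ x, (G.neighborSet x).Nonempty) (o : V) (n : ℕ) :
    ∃ S, o ∈ S ∧ ∀ k ≤ n, Covers G S (hitProb G o k) := by
  classical
  choose S hS using fun k => exists_covers hG (hitProb_support_finite hG hN o k)
  refine ⟨{o} ∪ (Finset.range (n + 1)).biUnion S, by simp, fun k hk => (hS k).mono ?_⟩
  exact (Finset.subset_biUnion_of_mem S (Finset.mem_range.2 (by omega))).trans
    Finset.subset_union_right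

lemma covers_truncGreen {G : SimpleGraph V} {o : V} {n : ℕ} {S : Finset V}
    (h : ∀ k ≤ n, Covers G S (hitProb G o k)) : Covers G S (truncGreen G o n) := by
  intro x hx
  obtain ⟨k, hk, hne⟩ := Finset.exists_ne_zero_of_sum_ne_zero hx
  exact h k (Finset.mem_range.1 hk).le x hne

/-- The Laplacian of the truncated Green function telescopes: a unit source at `o` minus the law
after `n` steps. -/
lemma card_mul_truncGreen_sub {G : SimpleGraph V} (hG : LocFinite G)
    (hN : ∀ x, (G.neighborSet x).Nonempty) (o : V) (n : ℕ) (x : V) :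
    (nbrs hG x).card * truncGreen G o n x - ∑ y ∈ nbrs hG x, truncGreen G o n y =
      (nbrs hG x).card * (hitProb G o 0 x - hitProb G o n x) := by
  have : ∑ y ∈ nbrs hG x, truncGreen G o n y =
      (nbrs hG x).card * ∑ k ∈ Finset.range n, hitProb G o (k + 1) x := by
    simp only [truncGreen]
    rw [Finset.sum_comm, Finset.mul_sum]
    exact Finset.sum_congr rfl fun k _ => (card_mul_hitProb_succ hG hN o k x).symm
  rw [this, truncGreen, ← mul_sub, ← Finset.sum_sub_distrib, Finset.sum_range_sub']

lemma dirForm_truncGreen {G : SimpleGraph V} (hG : LocFinite G)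
    (hN : ∀ x, (G.neighborSet x).Nonempty) {o : V} {n : ℕ} {S : Finset V} (ho : o ∈ S)
    {f : V → ℝ} (hf : Covers G S f) :
    dirForm G S f (truncGreen G o n) =
      2 * ((nbrs hG o).card * f o - ∑ x ∈ S, f x * ((nbrs hG x).card * hitProb G o n x)) := by
  classical
  rw [dirForm_eq hG hf]
  simp only [card_mul_truncGreen_sub hG hN, mul_sub, Finset.sum_sub_distrib]
  congr 2
  rw [Finset.sum_eq_single o]
  · rw [hitProb_zero, if_pos rfl]; ring
  · intro x _ hx
    rw [hitProb_zero, if_neg hx]; ring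
  · exact fun h => absurd ho h

lemma dirForm_truncGreen_self_le {G : SimpleGraph V} (hG : LocFinite G)
    (hN : ∀ x, (G.neighborSet x).Nonempty) {o : V} {n : ℕ} {S : Finset V} (ho : o ∈ S)
    (h : ∀ k ≤ n, Covers G S (hitProb G o k)) :
    dirForm G S (truncGreen G o n) (truncGreen G o n) ≤
      2 * ((nbrs hG o).card * truncGreen G o n o) := by
  rw [dirForm_truncGreen hG hN ho (covers_truncGreen h)]
  have : 0 ≤ ∑ x ∈ S, truncGreen G o n x * ((nbrs hG x).card * hitProb G o n x) :=
    Finset.sum_nonneg fun x _ => mul_nonneg (truncGreen_nonneg _ _ _ _)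
      (mul_nonneg (by positivity) (hitProb_nonneg _ _ _ _))
  linarith

/-! ### Equivalence of finite Green function and positive capacity -/

lemma green_eq_tsum {G : SimpleGraph V} (hG : LocFinite G)
    (hN : ∀ x, (G.neighborSet x).Nonempty) (o : V) :
    green G o o = ∑' n, ENNReal.ofReal (hitProb G o n o) := by
  simp only [green, hitProb, ENNReal.ofReal_toReal (walkProb_ne_top hG hN _ _ _)]

lemma green_lt_top_of_capPos_of_neighbors {G : SimpleGraph V} (hG : LocFinite G)
    (hN : ∀ x, (G.neighborSet x).Nonempty) {o : V} (h : CapPos G o) : green G o o < ∞ := by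
  obtain ⟨c, hc⟩ := h
  have key : ∀ n, truncGreen G o n o ≤ c * (2 * (nbrs hG o).card) := by
    intro n
    obtain ⟨S, ho, hS⟩ := exists_covers_hitProb hG hN o n
    have hcov := covers_truncGreen hS
    have h1 := hc (truncGreen G o n) (S.finite_toSet.subset fun x hx => (hcov x hx).1)
    rw [energy_eq_dirForm hcov, ← ENNReal.ofReal_coe_nnreal, ← ENNReal.ofReal_mul c.coe_nonneg,
      ENNReal.ofReal_le_ofReal_iff (mul_nonneg c.coe_nonneg (dirForm_self_nonneg _ _ _))] at h1
    have h2 := dirForm_truncGreen_self_le hG hN ho hS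
    -- The energy of the truncated Green function is linear in its value at `o`, whereas the
    -- capacity bound is quadratic in that value. Dividing gives a bound uniform in `n`.
    have h3 : truncGreen G o n o * truncGreen G o n o ≤
        (c * (2 * (nbrs hG o).card)) * truncGreen G o n o := by
      have := mul_le_mul_of_nonneg_left h2 c.coe_nonneg
      nlinarith
    rcases (truncGreen_nonneg G o n o).eq_or_lt with h0 | h0
    · rw [← h0]; positivity
    · exact le_of_mul_le_mul_right h3 h0
  rw [green_eq_tsum hG hN]
  refine lt_of_le_of_lt ?_ (ENNReal.ofReal_lt_top (r := c * (2 * (nbrs hG o).card)))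
  rw [ENNReal.tsum_eq_iSup_nat]
  refine iSup_le fun n => ?_
  rw [← ENNReal.ofReal_sum_of_nonneg fun _ _ => hitProb_nonneg _ _ _ _]
  exact ENNReal.ofReal_le_ofReal (key n)

/-- Reversibility: the transition operator is self-adjoint for the degree weights, because the
Dirichlet form is symmetric. -/
lemma sum_hitProb_symm {G : SimpleGraph V} (hG : LocFinite G)
    (hN : ∀ x, (G.neighborSet x).Nonempty) {o : V} {m n : ℕ} {S : Finset V}
    (hm : Covers G S (hitProb G o m)) (hn : Covers G S (hitProb G o n)) :
    ∑ x ∈ S, (nbrs hG x).card * hitProb G o (m + 1) x * hitProb G o n x =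
      ∑ x ∈ S, (nbrs hG x).card * hitProb G o m x * hitProb G o (n + 1) x := by
  have h1 := dirForm_eq hG hm (hitProb G o n)
  have h2 := dirForm_eq hG hn (hitProb G o m)
  rw [dirForm_comm, h2] at h1
  simp only [← card_mul_hitProb_succ hG hN, mul_sub, Finset.sum_sub_distrib] at h1
  have h3 : ∑ x ∈ S, hitProb G o n x * ((nbrs hG x).card * hitProb G o m x) =
    ∑ x ∈ S, hitProb G o m x * ((nbrs hG x).card * hitProb G o n x) :=
    Finset.sum_congr rfl fun x _ => by ring
  have h4 : ∑ x ∈ S, hitProb G o n x * ((nbrs hG x).card * hitProb G o (m + 1) x) =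
    ∑ x ∈ S, hitProb G o m x * ((nbrs hG x).card * hitProb G o (n + 1) x) := by linarith
  calc _ = ∑ x ∈ S, hitProb G o n x * ((nbrs hG x).card * hitProb G o (m + 1) x) :=
        Finset.sum_congr rfl fun x _ => by ring
    _ = _ := h4
    _ = _ := Finset.sum_congr rfl fun x _ => by ring

/-- Moving steps from one factor to the other by reversibility turns the degree-weighted sum of
`hitProb G o n x ^ 2` over `x` into the right-hand side; a single term is at most the sum. -/
lemma card_mul_hitProb_sq_le {G : SimpleGraph V} (hG : LocFinite G)
    (hN : ∀ x, (G.neighborSet x).Nonempty) (o x : V) (n : ℕ) :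
    (nbrs hG x).card * hitProb G o n x ^ 2 ≤ (nbrs hG o).card * hitProb G o (2 * n) o := by
  classical
  obtain ⟨S, ho, hS⟩ := exists_covers_hitProb hG hN o (2 * n)
  have key : ∀ k ≤ n, ∑ x ∈ S, (nbrs hG x).card * hitProb G o n x * hitProb G o n x =
      ∑ x ∈ S, (nbrs hG x).card * hitProb G o (n - k) x * hitProb G o (n + k) x := by
    intro k
    induction k with
    | zero => simp
    | succ k ih =>
      intro hk
      rw [ih (by omega), ← add_assoc,
        ← sum_hitProb_symm hG hN (hS (n - (k + 1)) (by omega)) (hS (n + k) (by omega))]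
      rw [show n - (k + 1) + 1 = n - k by omega]
  have h1 := key n le_rfl
  have h0 : ∑ x ∈ S, (nbrs hG x).card * hitProb G o 0 x * hitProb G o (2 * n) x =
      (nbrs hG o).card * hitProb G o (2 * n) o := by
    rw [Finset.sum_eq_single o]
    · rw [hitProb_zero, if_pos rfl, mul_one]
    · intro y _ hy
      rw [hitProb_zero, if_neg hy]; ring
    · exact fun h => absurd ho h
  rw [Nat.sub_self, ← two_mul, h0] at h1
  rw [← h1]
  by_cases hx : hitProb G o n x = 0
  · rw [hx]
    simp only [ne_eq, OfNat.ofNat_ne_zero, not_false_eq_true, zero_pow, mul_zero]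
    exact Finset.sum_nonneg fun y _ => by
      rw [mul_assoc]; exact mul_nonneg (by positivity) (mul_self_nonneg _)
  · rw [sq, ← mul_assoc]
    refine Finset.single_le_sum
      (f := fun x => (nbrs hG x).card * hitProb G o n x * hitProb G o n x) (fun y _ => ?_)
      (hS n (by omega) x hx).1
    rw [mul_assoc]; exact mul_nonneg (by positivity) (mul_self_nonneg _)

lemma capPos_of_green_lt_top_of_neighbors {G : SimpleGraph V} (hG : LocFinite G)
    (hN : ∀ x, (G.neighborSet x).Nonempty) {o : V} (h : green G o o < ∞) : CapPos G o := by
  classical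
  rw [green_eq_tsum hG hN] at h
  have hsum : Summable fun n => hitProb G o n o := by
    have := ENNReal.summable_toReal h.ne
    simpa [ENNReal.toReal_ofReal (hitProb_nonneg _ _ _ _)] using this
  set g := ∑' n, hitProb G o n o with hg
  have hg0 : 0 ≤ g := tsum_nonneg fun n => hitProb_nonneg _ _ _ _
  have hd : (0 : ℝ) < (nbrs hG o).card := by exact_mod_cast nbrs_card_pos hG (hN o)
  -- Convergence at every `x` follows from summability of the return probabilities at `o` alone,
  -- through the bound by the return probability after `2 * n` steps.
  have hlim : ∀ x, Filter.Tendsto (fun n => hitProb G o n x) Filter.atTop (nhds 0) := by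
    intro x
    have hdx : (0 : ℝ) < (nbrs hG x).card := by exact_mod_cast nbrs_card_pos hG (hN x)
    have h1 : Filter.Tendsto (fun n => (nbrs hG o).card * hitProb G o (2 * n) o) Filter.atTop
        (nhds ((nbrs hG o).card * 0)) :=
      (hsum.tendsto_atTop_zero.comp
        (Filter.tendsto_id.const_mul_atTop' (by norm_num : 0 < 2))).const_mul _
    rw [mul_zero] at h1
    have h2 : Filter.Tendsto (fun n => (nbrs hG x).card * hitProb G o n x ^ 2) Filter.atTop
        (nhds 0) := squeeze_zero (fun n => by positivity)
          (fun n => card_mul_hitProb_sq_le hG hN o x n) h1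
    have h3 := h2.const_mul ((nbrs hG x).card : ℝ)⁻¹
    simp only [← mul_assoc, inv_mul_cancel₀ hdx.ne', one_mul, mul_zero] at h3
    have h4 := h3.sqrt
    simpa [Real.sqrt_sq (hitProb_nonneg _ _ _ _)] using h4
  -- Cauchy–Schwarz against the truncated Green function gives, in the limit, `(2 * deg o * f o) ^ 2
  -- ≤ energy f * (2 * deg o * g)`; solving for `f o ^ 2` yields this constant.
  refine ⟨Real.toNNReal (g / (2 * (nbrs hG o).card)), fun f hf => ?_⟩
  obtain ⟨S₀, hS₀⟩ := exists_covers hG hf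
  have hbound : ∀ n, (2 * ((nbrs hG o).card * f o -
      ∑ x ∈ S₀, f x * ((nbrs hG x).card * hitProb G o n x))) ^ 2 ≤
      dirForm G S₀ f f * (2 * ((nbrs hG o).card * g)) := by
    intro n
    obtain ⟨S₁, ho, hS₁⟩ := exists_covers_hitProb hG hN o n
    have hf' := hS₀.mono (Finset.subset_union_left (s₂ := S₁))
    have ho' : o ∈ S₀ ∪ S₁ := Finset.mem_union_right _ ho
    have h1 := dirForm_sq_le G (S₀ ∪ S₁) f (truncGreen G o n)
    have h2 := dirForm_truncGreen_self_le hG hN ho'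
      fun k hk => (hS₁ k hk).mono (Finset.subset_union_right (s₁ := S₀))
    have h3 : truncGreen G o n o ≤ g :=
      hsum.sum_le_tsum _ fun _ _ => hitProb_nonneg _ _ _ _
    have h4 : dirForm G (S₀ ∪ S₁) f f = dirForm G S₀ f f := by
      have := (energy_eq_dirForm hf').symm.trans (energy_eq_dirForm hS₀)
      rwa [ENNReal.ofReal_eq_ofReal_iff (dirForm_self_nonneg _ _ _)
        (dirForm_self_nonneg _ _ _)] at this
    have h5 : ∑ x ∈ S₀ ∪ S₁, f x * ((nbrs hG x).card * hitProb G o n x) =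
        ∑ x ∈ S₀, f x * ((nbrs hG x).card * hitProb G o n x) := by
      symm
      refine Finset.sum_subset Finset.subset_union_left fun x _ hx => ?_
      have : f x = 0 := by
        by_contra hne
        exact hx (hS₀ x hne).1
      rw [this, zero_mul]
    rw [dirForm_truncGreen hG hN ho' hf', h5, h4] at h1
    refine h1.trans (mul_le_mul_of_nonneg_left (h2.trans ?_) (dirForm_self_nonneg _ _ _))
    nlinarith
  have hlim2 : Filter.Tendsto (fun n => (2 * ((nbrs hG o).card * f o -
      ∑ x ∈ S₀, f x * ((nbrs hG x).card * hitProb G o n x))) ^ 2) Filter.atTop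
      (nhds ((2 * ((nbrs hG o).card * f o -
      ∑ x ∈ S₀, f x * ((nbrs hG x).card * 0))) ^ 2)) := by
    refine (((tendsto_const_nhds.sub (tendsto_finsetSum _ fun x _ => ?_)).const_mul _).pow _)
    exact ((hlim x).const_mul _).const_mul _
  have h6 := le_of_tendsto' hlim2 hbound
  simp only [mul_zero, Finset.sum_const_zero, sub_zero] at h6
  rw [energy_eq_dirForm hS₀, ← ENNReal.ofReal_coe_nnreal,
    ← ENNReal.ofReal_mul (NNReal.coe_nonneg _)]
  refine ENNReal.ofReal_le_ofReal ?_
  rw [Real.coe_toNNReal _ (by positivity), div_mul_eq_mul_div, le_div_iff₀ (by positivity)]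
  nlinarith

lemma green_eq_top_of_isolated {G : SimpleGraph V} {o : V} (h : G.neighborSet o = ∅) :
    green G o o = ∞ := by
  classical
  have h1 : ∀ n, walkProb G n o o = 1 := by
    intro n
    induction n with
    | zero => simp [walkProb]
    | succ n ih =>
      rw [walkProb, tsum_eq_single o]
      · simp [stepProb, h, ih]
      · intro z hz
        simp [stepProb, h, hz.symm]
  simp [green, h1]

lemma subsingleton_of_isolated {G : SimpleGraph V} (hc : G.Connected) {x : V}
    (h : G.neighborSet x = ∅) : Subsingleton V := by
  by_contra hne
  rw [not_subsingleton_iff_nontrivial] at hne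
  obtain ⟨y, hy⟩ := hc.preconnected.exists_adj_of_nontrivial x
  exact (h ▸ (show y ∈ G.neighborSet x from hy) : y ∈ (∅ : Set V))

/-- The constant 1 is finitely supported and has no energy. This matches the convention that the
walk stays put on the one-point graph. -/
lemma not_capPos_of_subsingleton [Subsingleton V] (G : SimpleGraph V) (x : V) :
    ¬ CapPos G x := by
  classical
  rintro ⟨c, hc⟩
  have h1 := hc (fun _ => 1) (Set.toFinite _)
  simp [energy] at h1

/-- In a connected locally finite graph, the Green function is finite exactly at the vertices of
positive capacity. -/
theorem green_lt_top_iff {G : SimpleGraph V} (hG : LocFinite G) (hc : G.Connected) (x : V) :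
    green G x x < ∞ ↔ CapPos G x := by
  by_cases hN : ∀ x, (G.neighborSet x).Nonempty
  · exact ⟨capPos_of_green_lt_top_of_neighbors hG hN, green_lt_top_of_capPos_of_neighbors hG hN⟩
  · push Not at hN
    obtain ⟨y, hy⟩ := hN
    have := subsingleton_of_isolated hc hy
    obtain rfl := Subsingleton.elim x y
    simp [green_eq_top_of_isolated hy, not_capPos_of_subsingleton]

/-! ### Change of base point, test functions and comparison of graphs -/

lemma adj_le_energy {G : SimpleGraph V} {x y : V} (h : G.Adj x y) (f : V → ℝ) :
    ENNReal.ofReal ((f x - f y) ^ 2) ≤ energy G f := by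
  classical
  refine le_trans ?_ (ENNReal.le_tsum (x, y))
  simp [h]

lemma CapPos.of_adj {G : SimpleGraph V} {x y : V} (h : CapPos G x) (ha : G.Adj x y) :
    CapPos G y := by
  obtain ⟨c, hc⟩ := h
  refine ⟨2 * c + 2, fun f hf => ?_⟩
  calc ENNReal.ofReal (f y ^ 2)
      ≤ ENNReal.ofReal (2 * f x ^ 2 + 2 * (f x - f y) ^ 2) :=
        ENNReal.ofReal_le_ofReal (by nlinarith [sq_nonneg (2 * f x - f y)])
    _ = 2 * ENNReal.ofReal (f x ^ 2) + 2 * ENNReal.ofReal ((f x - f y) ^ 2) := by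
        rw [ENNReal.ofReal_add (by positivity) (by positivity),
          ENNReal.ofReal_mul (by norm_num), ENNReal.ofReal_mul (by norm_num)]
        simp
    _ ≤ 2 * (c * energy G f) + 2 * energy G f :=
        add_le_add (mul_le_mul_right (hc f hf) _) (mul_le_mul_right (adj_le_energy ha f) _)
    _ = _ := by push_cast; ring

lemma CapPos.of_connected {G : SimpleGraph V} {x : V} (h : CapPos G x) (hc : G.Connected) (y : V) :
    CapPos G y := by
  obtain ⟨w⟩ := hc.preconnected x y
  induction w with
  | nil => exact h
  | cons ha _ ih => exact ih (h.of_adj ha)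

lemma isTransient_of_capPos {G : SimpleGraph V} (hG : LocFinite G) (hc : G.Connected) {x : V}
    (h : CapPos G x) : IsTransient G :=
  ⟨hc, fun y => (green_lt_top_iff hG hc y).2 (h.of_connected hc y)⟩

lemma energy_const_mul (G : SimpleGraph V) (a : ℝ) (f : V → ℝ) :
    energy G (fun x => a * f x) = ENNReal.ofReal (a ^ 2) * energy G f := by
  classical
  rw [energy, energy, ← ENNReal.tsum_mul_left]
  refine tsum_congr fun e => ?_
  split_ifs
  · rw [← ENNReal.ofReal_mul (sq_nonneg a)]; congr 1; ring
  · simp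

lemma exists_energy_le_of_not_capPos {G : SimpleGraph V} {x : V} (h : ¬ CapPos G x)
    {ε : NNReal} (hε : 0 < ε) :
    ∃ f : V → ℝ, f.support.Finite ∧ f x = 1 ∧ energy G f ≤ ε := by
  simp only [CapPos, not_exists, not_forall, not_le] at h
  obtain ⟨f, hf, hlt⟩ := h ε⁻¹
  have hx : f x ≠ 0 := by
    intro h0
    simp [h0] at hlt
  refine ⟨fun y => (f x)⁻¹ * f y, hf.subset fun y hy => right_ne_zero_of_mul hy,
    inv_mul_cancel₀ hx, ?_⟩
  rw [energy_const_mul]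
  have h1 : energy G f ≤ ε * ENNReal.ofReal (f x ^ 2) := by
    calc energy G f = ε * (((ε⁻¹ : NNReal) : ℝ≥0∞) * energy G f) := by
          rw [← mul_assoc, ← ENNReal.coe_mul, mul_inv_cancel₀ hε.ne']; simp
      _ ≤ _ := mul_le_mul_right hlt.le _
  calc _ ≤ ENNReal.ofReal ((f x)⁻¹ ^ 2) * (ε * ENNReal.ofReal (f x ^ 2)) :=
        mul_le_mul_right h1 _
    _ = ε * ENNReal.ofReal ((f x)⁻¹ ^ 2 * f x ^ 2) := by
        rw [ENNReal.ofReal_mul (by positivity)]; ring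
    _ ≤ _ := by rw [← mul_pow, inv_mul_cancel₀ hx]; simp

lemma not_capPos_of_forall_exists {G : SimpleGraph V} {x : V}
    (h : ∀ ε : NNReal, 0 < ε → ∃ f : V → ℝ, f.support.Finite ∧ f x = 1 ∧ energy G f ≤ ε) :
    ¬ CapPos G x := by
  rintro ⟨c, hc⟩
  obtain ⟨f, hf, hx, hE⟩ := h (c + 1)⁻¹ (by positivity)
  have h1 := (hc f hf).trans (mul_le_mul_right hE _)
  rw [hx, one_pow, ENNReal.ofReal_one, ← ENNReal.coe_mul, ← ENNReal.coe_one,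
    ENNReal.coe_le_coe, ← div_eq_mul_inv, le_div_iff₀ (by positivity), one_mul] at h1
  exact absurd h1 (not_le.2 (lt_add_one c))

/-- Isolates the contribution of a family of distinct oriented edges, such as those between two
levels; this is the input of the Cauchy–Schwarz lower bounds on energy. -/
lemma sum_sq_le_energy {ι : Type*} {G : SimpleGraph V} {s : Finset ι} {a b : ι → V}
    (hinj : Set.InjOn (fun i => (a i, b i)) s) (hadj : ∀ i ∈ s, G.Adj (a i) (b i)) (f : V → ℝ) :
    ENNReal.ofReal (∑ i ∈ s, (f (a i) - f (b i)) ^ 2) ≤ energy G f := by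
  classical
  rw [ENNReal.ofReal_sum_of_nonneg fun _ _ => sq_nonneg _]
  refine le_trans (le_of_eq ?_) (ENNReal.sum_le_tsum (s.image fun i => (a i, b i)))
  rw [Finset.sum_image hinj]
  exact Finset.sum_congr rfl fun i hi => by simp [hadj i hi]

lemma energy_comp_le {W : Type*} {X : SimpleGraph W} {G : SimpleGraph V} {φ : W → V}
    (hφ : Function.Injective φ) (h : ∀ u v, X.Adj u v → G.Adj (φ u) (φ v)) (f : V → ℝ) :
    energy X (f ∘ φ) ≤ energy G f := by
  classical
  refine le_trans (ENNReal.tsum_le_tsum fun e => ?_)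
    (ENNReal.tsum_comp_le_tsum_of_injective (hφ.prodMap hφ) _)
  split_ifs with h1 h2
  · exact le_rfl
  · exact absurd (h _ _ h1) h2
  · exact zero_le
  · exact le_rfl

lemma CapPos.of_injective {W : Type*} {X : SimpleGraph W} {G : SimpleGraph V} {φ : W → V}
    (hφ : Function.Injective φ) (h : ∀ u v, X.Adj u v → G.Adj (φ u) (φ v)) {x : W}
    (hX : CapPos X x) : CapPos G (φ x) := by
  obtain ⟨c, hc⟩ := hX
  refine ⟨c, fun f hf => (hc (f ∘ φ) ?_).trans (mul_le_mul_right (energy_comp_le hφ h f) _)⟩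
  exact hf.preimage hφ.injOn

/-! ### Bernoulli percolation -/

lemma measurableSet_mem_set {ι : Type*} (i : ι) : MeasurableSet {ω : Set ι | i ∈ ω} :=
  measurableSet_setOfPred.2 (measurable_set_mem i)

lemma measurableSet_subset_set {ι : Type*} (A : Finset ι) :
    MeasurableSet {ω : Set ι | ↑A ⊆ ω} := by
  have : {ω : Set ι | ↑A ⊆ ω} = ⋂ i ∈ A, {ω : Set ι | i ∈ ω} := by
    ext ω; simp [Set.subset_def]
  rw [this]
  exact Finset.measurableSet_biInter _ fun i _ => measurableSet_mem_set i

lemma setBernoulli_real_subset {ι : Type*} {u : Set ι} (p : I) {A : Finset ι} (hA : ↑A ⊆ u) :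
    (setBernoulli u p).real {ω | ↑A ⊆ ω} = (p : ℝ) ^ A.card := by
  have h1 : (fun q : ι → Prop => {i | q i}) ⁻¹' {ω : Set ι | ↑A ⊆ ω} =
      Set.pi A fun _ => {True} := by
    ext q
    simp [Set.subset_def, Set.mem_pi]
  rw [measureReal_def, setBernoulli_apply', h1, Measure.infinitePi_pi _ (by simp),
    Finset.prod_congr rfl (g := fun _ => ENNReal.ofReal p), Finset.prod_const,
    ← ENNReal.ofReal_pow p.2.1, ENNReal.toReal_ofReal (pow_nonneg p.2.1 _)]
  intro i hi
  have : i ∈ u := hA hi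
  simp only [this]
  have h0 : Measure.dirac False {True} = 0 := by
    rw [Measure.dirac_apply' _ (by simp)]; simp
  rw [Measure.add_apply, Measure.smul_apply, Measure.smul_apply, h0,
    Measure.dirac_apply_of_mem (by simp), smul_zero, add_zero, ENNReal.smul_def, smul_eq_mul,
    mul_one, ENNReal.ofReal, Real.toNNReal_of_nonneg p.2.1]
  rfl

/-- Inclusion–exclusion for independent blocks: the edges of `A` are open and none of the disjoint
blocks `B i` is entirely open. -/
lemma setBernoulli_real_blocks {ι κ : Type*} [DecidableEq ι] {u : Set ι} (p : I)
    {B : κ → Finset ι} (s : Finset κ) :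
    ∀ {A : Finset ι}, ↑A ⊆ u → (∀ i ∈ s, ↑(B i) ⊆ u) →
    (s : Set κ).PairwiseDisjoint B → (∀ i ∈ s, Disjoint A (B i)) →
    (setBernoulli u p).real {ω | ↑A ⊆ ω ∧ ∀ i ∈ s, ¬ ↑(B i) ⊆ ω} =
      (p : ℝ) ^ A.card * ∏ i ∈ s, (1 - (p : ℝ) ^ (B i).card) := by
  classical
  induction s using Finset.induction_on with
  | empty =>
    intro A hA _ _ _
    simp [setBernoulli_real_subset p hA]
  | insert i s hi ih =>
    intro A hA hB hd hAd
    -- Removing one block writes the event as a difference of two events of the same kind, the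
    -- second with `A` enlarged by `B i`. The induction therefore needs `A` general.
    have hset : {ω : Set ι | ↑A ⊆ ω ∧ ∀ j ∈ insert i s, ¬ ↑(B j) ⊆ ω} =
        {ω | ↑A ⊆ ω ∧ ∀ j ∈ s, ¬ ↑(B j) ⊆ ω} \
          {ω | ↑(A ∪ B i) ⊆ ω ∧ ∀ j ∈ s, ¬ ↑(B j) ⊆ ω} := by
      ext ω
      simp only [Finset.mem_insert, forall_eq_or_imp, Set.mem_ofPred_eq, mem_sdiff,
        Finset.coe_union, Set.union_subset_iff]
      tauto
    have hsub : {ω : Set ι | ↑(A ∪ B i) ⊆ ω ∧ ∀ j ∈ s, ¬ ↑(B j) ⊆ ω} ⊆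
        {ω | ↑A ⊆ ω ∧ ∀ j ∈ s, ¬ ↑(B j) ⊆ ω} := by
      rintro ω ⟨h1, h2⟩
      exact ⟨(by simp at h1; exact h1.1), h2⟩
    have hmeas : MeasurableSet {ω : Set ι | ↑(A ∪ B i) ⊆ ω ∧ ∀ j ∈ s, ¬ ↑(B j) ⊆ ω} := by
      have : {ω : Set ι | ↑(A ∪ B i) ⊆ ω ∧ ∀ j ∈ s, ¬ ↑(B j) ⊆ ω} =
          {ω | ↑(A ∪ B i) ⊆ ω} ∩ ⋂ j ∈ s, {ω | ↑(B j) ⊆ ω}ᶜ := by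
        ext ω; simp
      rw [this]
      exact (measurableSet_subset_set _).inter
        (Finset.measurableSet_biInter _ fun j _ => (measurableSet_subset_set _).compl)
    have hBi := hB i (Finset.mem_insert_self _ _)
    have hAi := hAd i (Finset.mem_insert_self _ _)
    have hd' : (s : Set κ).PairwiseDisjoint B := hd.subset (by simp)
    rw [hset, measureReal_sdiff hsub hmeas,
      ih hA (fun j hj => hB j (Finset.mem_insert_of_mem hj)) hd'
        (fun j hj => hAd j (Finset.mem_insert_of_mem hj)),
      ih (by simpa using ⟨hA, hBi⟩) (fun j hj => hB j (Finset.mem_insert_of_mem hj)) hd' ?_,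
      Finset.card_union_of_disjoint hAi, Finset.prod_insert hi, pow_add]
    · ring
    · intro j hj
      refine Finset.disjoint_union_left.2 ⟨hAd j (Finset.mem_insert_of_mem hj), ?_⟩
      exact hd (by simp) (by simp [hj]) (by rintro rfl; exact hi hj)

lemma setBernoulli_subset {ι : Type*} {u : Set ι} (p : I) {A : Finset ι} (hA : ↑A ⊆ u) :
    setBernoulli u p {ω | ↑A ⊆ ω} = ENNReal.ofReal p ^ A.card := by
  rw [← ENNReal.ofReal_pow p.2.1, ← setBernoulli_real_subset p hA, ofReal_measureReal]

lemma setBernoulli_disjoint {ι : Type*} {u : Set ι} (p : I) {A : Finset ι} (hA : ↑A ⊆ u) :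
    setBernoulli u p {ω | ∀ i ∈ A, i ∉ ω} = ENNReal.ofReal (1 - p) ^ A.card := by
  classical
  have h := setBernoulli_real_blocks (u := u) p (B := fun i : ι => ({i} : Finset ι)) A (A := ∅)
    (by simp) (fun i hi => by simpa using hA hi)
    (fun i _ j _ hij => by simpa [Function.onFun] using hij) (by simp)
  simp only [Finset.coe_empty, Set.empty_subset, true_and, Finset.coe_singleton,
    Set.singleton_subset_iff, Finset.card_empty, pow_zero, one_mul, Finset.card_singleton,
    pow_one, Finset.prod_const] at h
  rw [← ENNReal.ofReal_pow (by linarith [p.2.2]), ← h, ofReal_measureReal]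

/-! ### Counting paths -/

/-- Edge lists rather than walks are counted, since the endpoint, and with it the type of the walk,
varies. -/
lemma exists_finset_edges_walk {W : Type*} (K : SimpleGraph W) {D : ℕ}
    (hD : ∀ w, (K.neighborSet w).encard ≤ D) (n : ℕ) (y : W) :
    ∃ P : Finset (List (Sym2 W)), P.card ≤ D ^ n ∧
      ∀ v (w : K.Walk y v), w.length = n → w.edges ∈ P := by
  classical
  induction n generalizing y with
  | zero =>
    refine ⟨{[]}, by simp, fun v w hw => ?_⟩
    cases w with
    | nil => simp
    | cons _ _ => simp at hw
  | succ n ih =>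
    choose P hP1 hP2 using ih
    have hfin : (K.neighborSet y).Finite :=
      Set.finite_of_encard_le_coe (hD y)
    refine ⟨hfin.toFinset.biUnion fun z => (P z).image (List.cons s(y, z)), ?_, fun v w hw => ?_⟩
    · calc _ ≤ ∑ z ∈ hfin.toFinset, D ^ n :=
            Finset.card_biUnion_le.trans (Finset.sum_le_sum fun z _ =>
              Finset.card_image_le.trans (hP1 z))
        _ = hfin.toFinset.card * D ^ n := by simp
        _ ≤ D * D ^ n := by
            refine Nat.mul_le_mul_right _ ?_
            have := hD y
            rw [hfin.encard_eq_coe_toFinset_card] at this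
            exact_mod_cast this
        _ = D ^ (n + 1) := by ring
    · cases w with
      | nil => simp at hw
      | cons h w =>
        rename_i z
        simp only [SimpleGraph.Walk.length_cons, add_left_inj] at hw
        simp only [Finset.mem_biUnion, Finite.mem_toFinset, Finset.mem_image]
        exact ⟨z, h, w.edges, hP2 z v w hw, by simp⟩

/-- Union bound over the self-avoiding paths of length `n`. -/
lemma measure_exists_path_le {W Ω : Type*} [MeasurableSpace Ω] (μ : Measure Ω)
    (K : SimpleGraph W) {D : ℕ} (hD : ∀ w, (K.neighborSet w).encard ≤ D) (A : Sym2 W → Set Ω)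
    {q : ℝ≥0∞} (hA : ∀ s : Finset (Sym2 W), ↑s ⊆ K.edgeSet →
      μ {ω | ∀ e ∈ s, ω ∈ A e} ≤ q ^ s.card) (n : ℕ) (y : W) :
    μ {ω | ∃ v, ∃ w : K.Walk y v, w.IsPath ∧ w.length = n ∧ ∀ e ∈ w.edges, ω ∈ A e} ≤
      (D * q) ^ n := by
  classical
  obtain ⟨P, hP1, hP2⟩ := exists_finset_edges_walk K hD n y
  set P' := P.filter fun l => l.Nodup ∧ l.length = n ∧ ∀ e ∈ l, e ∈ K.edgeSet with hP'
  calc _ ≤ μ (⋃ l ∈ P', {ω | ∀ e ∈ l.toFinset, ω ∈ A e}) := by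
        refine measure_mono ?_
        rintro ω ⟨v, w, hw, hn, hA⟩
        simp only [Set.mem_iUnion]
        refine ⟨w.edges, ?_, by simpa using hA⟩
        rw [hP', Finset.mem_filter]
        exact ⟨hP2 v w hn, hw.isTrail.edges_nodup, by simpa using hn,
          fun e he => w.edges_subset_edgeSet he⟩
    _ ≤ ∑ l ∈ P', μ {ω | ∀ e ∈ l.toFinset, ω ∈ A e} := measure_biUnion_finset_le _ _
    _ ≤ ∑ l ∈ P', q ^ n := by
        refine Finset.sum_le_sum fun l hl => ?_
        rw [hP', Finset.mem_filter] at hl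
        refine (hA _ ?_).trans (le_of_eq ?_)
        · intro e he
          exact hl.2.2.2 e (by simpa using he)
        · rw [List.toFinset_card_of_nodup hl.2.1, hl.2.2.1]
    _ = P'.card * q ^ n := by simp
    _ ≤ (D ^ n : ℕ) * q ^ n := by
        gcongr
        exact (Finset.card_filter_le _ _).trans hP1
    _ = _ := by push_cast; rw [mul_pow]

/-! ### Clusters -/

lemma openGraph_le (G : SimpleGraph V) (ω : Set (Sym2 V)) : openGraph G ω ≤ G :=
  fun _ _ h => h.1

lemma LocFinite.mono {G G' : SimpleGraph V} (h : LocFinite G) (hle : G' ≤ G) : LocFinite G' :=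
  fun v => (h v).subset fun _ hw => hle hw

lemma finite_walk_endpoints {G : SimpleGraph V} (hG : LocFinite G) (n : ℕ) (x : V) :
    {v | ∃ w : G.Walk x v, w.length = n}.Finite := by
  induction n generalizing x with
  | zero =>
    refine (Set.finite_singleton x).subset ?_
    rintro v ⟨w, hw⟩
    exact (SimpleGraph.Walk.eq_of_length_eq_zero hw).symm
  | succ n ih =>
    refine ((hG x).biUnion fun y _ => ih y).subset ?_
    rintro v ⟨w, hw⟩
    cases w with
    | nil => simp at hw
    | cons h w => exact mem_biUnion (show _ ∈ G.neighborSet x from h) ⟨w, by simpa using hw⟩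

/-- If every path from `x` were shorter than `n`, the component of `x` would lie in a ball, which is
finite; longer paths are cut to length `n`. -/
lemma exists_path_of_infinite {G : SimpleGraph V} (hG : LocFinite G) {x : V}
    (h : {v | G.Reachable x v}.Infinite) (n : ℕ) :
    ∃ v, ∃ w : G.Walk x v, w.IsPath ∧ w.length = n := by
  classical
  by_contra hcon
  push Not at hcon
  refine h (((Set.finite_Iio n).biUnion fun k _ => finite_walk_endpoints hG k x).subset ?_)
  rintro v hv
  obtain ⟨w, hw⟩ := hv.exists_isPath
  refine mem_biUnion (x := w.length) ?_ ⟨w, rfl⟩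
  by_contra hlen
  simp only [mem_Iio, not_lt] at hlen
  exact hcon _ (w.take n) (hw.take n) (by simp [SimpleGraph.Walk.take_length, hlen])

/-- The critical probability of a graph with bounded degrees is positive. -/
lemma pc_pos {G : SimpleGraph V} {D : ℕ} (hD : ∀ w, (G.neighborSet w).encard ≤ D) (x : V) :
    0 < pc G x := by
  have hG : LocFinite G := fun v => Set.finite_of_encard_le_coe (hD v)
  have hpos : (0 : ℝ) < 1 / (D + 1) := by positivity
  have hle : 1 / ((D : ℝ) + 1) ≤ 1 := by
    rw [div_le_one (by positivity)]; linarith [(Nat.cast_nonneg D : (0 : ℝ) ≤ D)]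
  refine lt_of_lt_of_le (b := (⟨1 / (D + 1), hpos.le, hle⟩ : I)) hpos (le_sInf fun p hp => ?_)
  by_contra hlt
  rw [not_le] at hlt
  have hlt' : (p : ℝ) < 1 / (D + 1) := hlt
  refine hp.2.ne' ?_
  have hb : ∀ n, percMeasure G p {ω | (cluster G ω x).Infinite} ≤
      ((D : ℝ≥0∞) * ENNReal.ofReal p) ^ n := by
    intro n
    refine le_trans (measure_mono ?_) (measure_exists_path_le (percMeasure G p) G hD
      (fun e => {ω | e ∈ ω}) (q := ENNReal.ofReal p) (fun s hs => ?_) n x)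
    · intro ω hω
      obtain ⟨v, w, hw, hn⟩ := exists_path_of_infinite (hG.mono (openGraph_le G ω)) hω n
      refine ⟨v, w.mapLe (openGraph_le G ω), ?_, by simpa using hn, ?_⟩
      · exact hw.mapLe _
      · intro e he
        rw [SimpleGraph.Walk.edges_mapLe_eq_edges] at he
        have := w.edges_subset_edgeSet he
        induction e with
        | h a b => exact this.2
    · exact (setBernoulli_subset p hs).le
  have hlt1 : (D : ℝ≥0∞) * ENNReal.ofReal p < 1 := by
    rw [← ENNReal.ofReal_natCast, ← ENNReal.ofReal_mul (by positivity), ← ENNReal.ofReal_one]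
    refine (ENNReal.ofReal_lt_ofReal_iff one_pos).2 ?_
    rw [lt_div_iff₀ (by positivity)] at hlt'
    nlinarith [p.2.1]
  exact le_antisymm (ge_of_tendsto' (ENNReal.tendsto_pow_atTop_nhds_zero_of_lt_one hlt1) hb)
    zero_le

/-! ### The square lattice -/

lemma squareLattice_adj {x y : ℤ × ℤ} :
    squareLattice.Adj x y ↔ |x.1 - y.1| + |x.2 - y.2| = 1 := Iff.rfl

lemma squareLattice_adj_iff {x y : ℤ × ℤ} : squareLattice.Adj x y ↔
    y ∈ ({(x.1 + 1, x.2), (x.1 - 1, x.2), (x.1, x.2 + 1), (x.1, x.2 - 1)} : Finset (ℤ × ℤ)) := by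
  obtain ⟨a, b⟩ := x
  obtain ⟨c, d⟩ := y
  simp only [squareLattice_adj, Finset.mem_insert, Finset.mem_singleton, Prod.mk.injEq]
  grind

lemma squareLattice_degree_le (x : ℤ × ℤ) : (squareLattice.neighborSet x).encard ≤ 4 := by
  have : squareLattice.neighborSet x =
      ({(x.1 + 1, x.2), (x.1 - 1, x.2), (x.1, x.2 + 1), (x.1, x.2 - 1)} : Finset (ℤ × ℤ)) := by
    ext y
    exact squareLattice_adj_iff
  rw [this, Set.encard_coe_eq_coe_finsetCard]
  exact_mod_cast Finset.card_le_four

lemma squareLattice_connected : squareLattice.Connected := by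
  have h1 : ∀ (n : ℕ) (a b : ℤ), squareLattice.Reachable (a, b) (a + n, b) := by
    intro n a b
    induction n with
    | zero => simp
    | succ n ih =>
      exact ih.trans (SimpleGraph.Adj.reachable (by rw [squareLattice_adj]; simp))
  have h2 : ∀ (n : ℕ) (a b : ℤ), squareLattice.Reachable (a, b) (a, b + n) := by
    intro n a b
    induction n with
    | zero => simp
    | succ n ih =>
      exact ih.trans (SimpleGraph.Adj.reachable (by rw [squareLattice_adj]; simp))
  have h3 : ∀ a b c : ℤ, squareLattice.Reachable (a, b) (c, b) := by
    intro a b c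
    rcases le_total a c with h | h
    · have := h1 (c - a).toNat a b
      rwa [Int.toNat_of_nonneg (by omega), add_sub_cancel] at this
    · have := h1 (a - c).toNat c b
      rw [Int.toNat_of_nonneg (by omega), add_sub_cancel] at this
      exact this.symm
  have h4 : ∀ a b c : ℤ, squareLattice.Reachable (a, b) (a, c) := by
    intro a b c
    rcases le_total b c with h | h
    · have := h2 (c - b).toNat a b
      rwa [Int.toNat_of_nonneg (by omega), add_sub_cancel] at this
    · have := h2 (b - c).toNat a c
      rw [Int.toNat_of_nonneg (by omega), add_sub_cancel] at this
      exact this.symm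
  exact { preconnected := fun x y => (h3 x.1 x.2 y.1).trans (h4 y.1 x.2 y.2) }

/-- The sup norm on `ℤ²`, with values in `ℕ`. -/
def supNorm (x : ℤ × ℤ) : ℕ := max x.1.natAbs x.2.natAbs

/-- A logarithmic cutoff on the ball of radius `M` of `ℤ²`. -/
def logCutoff (M : ℕ) (x : ℤ × ℤ) : ℝ := ∑ k ∈ Finset.Ico (supNorm x) M, 1 / ((k : ℝ) + 1)

lemma supNorm_le_of_adj {x y : ℤ × ℤ} (h : squareLattice.Adj x y) :
    supNorm y ≤ supNorm x + 1 := by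
  obtain ⟨a, b⟩ := x
  obtain ⟨c, d⟩ := y
  rw [squareLattice_adj] at h
  simp only [supNorm] at *
  grind

lemma logCutoff_sub_sq_le_aux {M : ℕ} {x y : ℤ × ℤ} (h : supNorm y ≤ supNorm x + 1)
    (h' : supNorm x ≤ supNorm y) :
    (logCutoff M x - logCutoff M y) ^ 2 ≤ (1 / ((supNorm x : ℝ) + 1)) ^ 2 := by
  rcases h'.eq_or_lt with he | hlt
  · simp only [logCutoff, he, sub_self, zero_pow two_ne_zero]
    positivity
  · have hy : supNorm y = supNorm x + 1 := by omega
    by_cases hM : supNorm x < M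
    · simp only [logCutoff]
      rw [Finset.sum_eq_sum_Ico_succ_bot hM, hy, add_sub_cancel_right]
    · simp only [logCutoff]
      rw [Finset.Ico_eq_empty (by omega), Finset.Ico_eq_empty (by omega)]
      simp only [Finset.sum_empty, sub_self, zero_pow two_ne_zero]
      positivity

lemma logCutoff_sub_sq_le {M : ℕ} {x y : ℤ × ℤ} (h : squareLattice.Adj x y) :
    (logCutoff M x - logCutoff M y) ^ 2 ≤ 4 / ((supNorm x : ℝ) + 1) ^ 2 := by
  rcases le_total (supNorm x) (supNorm y) with hle | hle
  · refine (logCutoff_sub_sq_le_aux (supNorm_le_of_adj h) hle).trans ?_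
    rw [div_pow, one_pow]
    gcongr
    norm_num
  · have h1 := supNorm_le_of_adj h.symm
    rw [← neg_sub, neg_sq]
    refine (logCutoff_sub_sq_le_aux h1 hle).trans ?_
    -- When `x` is the outer end, the increment is controlled at the inner end `y`; passing back to
    -- `x` costs a factor 2, whence the 4 after squaring.
    have h2 : (supNorm x : ℝ) + 1 ≤ 2 * (supNorm y + 1) := by
      have : (supNorm x : ℝ) ≤ supNorm y + 1 := by exact_mod_cast h1
      linarith [(Nat.cast_nonneg (supNorm y) : (0 : ℝ) ≤ _)]
    rw [div_pow, one_pow, div_le_div_iff₀ (by positivity) (by positivity)]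
    nlinarith [(Nat.cast_nonneg (supNorm x) : (0 : ℝ) ≤ _)]

lemma logCutoff_covers (M : ℕ) : Covers squareLattice
    ((Finset.range (M + 1)).biUnion fun n => Finset.box (α := ℤ × ℤ) n) (logCutoff M) := by
  have hmem : ∀ y : ℤ × ℤ, supNorm y ≤ M →
      y ∈ (Finset.range (M + 1)).biUnion fun n => Finset.box (α := ℤ × ℤ) n := by
    intro y hy
    simp only [Finset.mem_biUnion, Finset.mem_range, Int.mem_box]
    exact ⟨supNorm y, by omega, rfl⟩
  intro x hx
  have h1 : supNorm x < M := by
    by_contra hlt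
    exact hx (by rw [logCutoff, Finset.Ico_eq_empty hlt, Finset.sum_empty])
  exact ⟨hmem x h1.le, fun y hy => hmem y (by have := supNorm_le_of_adj hy; omega)⟩

/-- The squared increments at radius `n` are of order `1 / (n + 1) ^ 2` and the sphere has at most
`8 * (n + 1)` points. With 4 neighbours and increments of at most `4 / (n + 1) ^ 2`, the constant is
`8 * 4 * 4 = 128`. -/
lemma energy_logCutoff_le (M : ℕ) : energy squareLattice (logCutoff M) ≤
    ENNReal.ofReal (128 * ∑ n ∈ Finset.range (M + 1), 1 / ((n : ℝ) + 1)) := by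
  classical
  rw [energy_eq_dirForm (logCutoff_covers M)]
  refine ENNReal.ofReal_le_ofReal ?_
  rw [dirForm]
  set S := (Finset.range (M + 1)).biUnion fun n => Finset.box (α := ℤ × ℤ) n with hS
  calc _ ≤ ∑ x ∈ S, 16 / ((supNorm x : ℝ) + 1) ^ 2 := by
        refine Finset.sum_le_sum fun x _ => ?_
        rw [← Finset.sum_filter]
        calc _ ≤ ∑ y ∈ S.filter fun y => squareLattice.Adj x y,
              4 / ((supNorm x : ℝ) + 1) ^ 2 := by
              refine Finset.sum_le_sum fun y hy => ?_
              rw [← sq]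
              exact logCutoff_sub_sq_le (Finset.mem_filter.1 hy).2
          _ = (S.filter fun y => squareLattice.Adj x y).card *
                (4 / ((supNorm x : ℝ) + 1) ^ 2) := by simp
          _ ≤ 4 * (4 / ((supNorm x : ℝ) + 1) ^ 2) := by
              gcongr
              have h1 : (S.filter fun y => squareLattice.Adj x y) ⊆ {(x.1 + 1, x.2),
                  (x.1 - 1, x.2), (x.1, x.2 + 1), (x.1, x.2 - 1)} := fun y hy =>
                squareLattice_adj_iff.1 (Finset.mem_filter.1 hy).2
              exact_mod_cast (Finset.card_le_card h1).trans Finset.card_le_four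
          _ = _ := by ring
    _ = ∑ n ∈ Finset.range (M + 1), ∑ x ∈ Finset.box (α := ℤ × ℤ) n,
          16 / ((supNorm x : ℝ) + 1) ^ 2 := by
        refine Finset.sum_biUnion fun m _ n _ hmn => ?_
        refine Finset.disjoint_left.2 fun x hx hx' => hmn ?_
        rw [Int.mem_box] at hx hx'
        exact hx.symm.trans hx'
    _ = ∑ n ∈ Finset.range (M + 1), (Finset.box (α := ℤ × ℤ) n).card *
          (16 / ((n : ℝ) + 1) ^ 2) := by
        refine Finset.sum_congr rfl fun n _ => ?_
        rw [← nsmul_eq_mul]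
        refine Finset.sum_eq_card_nsmul fun x hx => ?_
        rw [Int.mem_box] at hx
        simp only [supNorm, hx]
    _ ≤ ∑ n ∈ Finset.range (M + 1), 128 * (1 / ((n : ℝ) + 1)) := by
        refine Finset.sum_le_sum fun n _ => ?_
        have h1 : ((Finset.box (α := ℤ × ℤ) n).card : ℝ) ≤ 8 * (n + 1) := by
          rcases Nat.eq_zero_or_pos n with rfl | hn
          · simp
          · rw [Int.card_box hn.ne']; push_cast; linarith
        calc _ ≤ (8 * ((n : ℝ) + 1)) * (16 / ((n : ℝ) + 1) ^ 2) := by gcongr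
          _ = _ := by field_simp; norm_num
    _ = _ := by rw [Finset.mul_sum]

/-- Recurrence of the square lattice. -/
lemma squareLattice_not_capPos (x : ℤ × ℤ) : ¬ CapPos squareLattice x := by
  intro hx
  obtain ⟨c, hc⟩ := hx.of_connected squareLattice_connected (0, 0)
  have key : ∀ M : ℕ, (∑ n ∈ Finset.range M, 1 / ((n : ℝ) + 1)) ^ 2 ≤
      c * (128 * (∑ n ∈ Finset.range M, 1 / ((n : ℝ) + 1) + 1)) := by
    intro M
    have h1 := (hc (logCutoff M) ((Finset.finite_toSet _).subset
      fun x hx => (logCutoff_covers M x hx).1)).trans (mul_le_mul_right (energy_logCutoff_le M) _)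
    rw [← ENNReal.ofReal_coe_nnreal, ← ENNReal.ofReal_mul c.coe_nonneg,
      ENNReal.ofReal_le_ofReal_iff (by positivity)] at h1
    have h2 : logCutoff M (0, 0) = ∑ n ∈ Finset.range M, 1 / ((n : ℝ) + 1) := by
      simp [logCutoff, supNorm]
    rw [h2, Finset.sum_range_succ] at h1
    refine h1.trans ?_
    gcongr
    rw [div_le_one (by positivity)]
    linarith [(Nat.cast_nonneg M : (0 : ℝ) ≤ M)]
  -- With `H` the harmonic sum, `H ^ 2 ≤ 128 * c * (H + 1) ≤ 256 * c * H` once `H ≥ 1`, so `H ≥ 256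
  -- * c + 1` is contradictory.
  obtain ⟨M, hM⟩ := (Real.tendsto_sum_range_one_div_nat_succ_atTop.eventually_ge_atTop
    (256 * (c : ℝ) + 1)).exists
  have h1 := key M
  set H := ∑ n ∈ Finset.range M, 1 / ((n : ℝ) + 1)
  have hc0 := c.coe_nonneg
  nlinarith

/-! ### Contours in the dual lattice -/

/-- A vertex `(i, j)` of the dual lattice stands for the face `[i, i + 1] × [j, j + 1]`; the dual
of an edge between two faces is the edge they share. -/
def dualEdge : Sym2 (ℤ × ℤ) → Sym2 (ℤ × ℤ) :=
  Sym2.lift ⟨fun a b => s((max a.1 b.1, max a.2 b.2),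
    (max a.1 b.1 + |a.2 - b.2|, max a.2 b.2 + |a.1 - b.1|)), fun a b => by
      dsimp only
      rw [max_comm a.1, max_comm a.2, abs_sub_comm a.1, abs_sub_comm a.2]⟩

lemma dualEdge_mk (a b : ℤ × ℤ) : dualEdge s(a, b) = s((max a.1 b.1, max a.2 b.2),
    (max a.1 b.1 + |a.2 - b.2|, max a.2 b.2 + |a.1 - b.1|)) := rfl

lemma dualEdge_mem {e : Sym2 (ℤ × ℤ)} (he : e ∈ squareLattice.edgeSet) :
    dualEdge e ∈ squareLattice.edgeSet := by
  induction e with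
  | h a b =>
    rw [dualEdge_mk, SimpleGraph.mem_edgeSet, squareLattice_adj]
    rw [SimpleGraph.mem_edgeSet, squareLattice_adj] at he
    grind

lemma dualEdge_injOn : Set.InjOn dualEdge squareLattice.edgeSet := by
  intro e he e' he' h
  induction e with
  | h a b =>
    induction e' with
    | h a' b' =>
      obtain ⟨a1, a2⟩ := a
      obtain ⟨b1, b2⟩ := b
      obtain ⟨c1, c2⟩ := a'
      obtain ⟨d1, d2⟩ := b'
      rw [SimpleGraph.mem_edgeSet, squareLattice_adj] at he he'
      simp only [dualEdge_mk, Sym2.eq_iff, Prod.mk.injEq] at h ⊢ he he'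
      grind

/-- The sum of a closed one-cochain over the faces of a region with no boundary. -/
lemma parity_row_sum {c k : ℤ → ℤ → ZMod 2} {R : ℕ}
    (hc : ∀ i j, c i j ≠ 0 → (-R < i ∧ i < R) ∧ (-R < j ∧ j < R))
    (hh : ∀ i j, k i j * (c i (j + 1) + c (i + 1) (j + 1)) =
      k i (j + 1) * (c i (j + 1) + c (i + 1) (j + 1)))
    (hv : ∀ i j, k i j * (c (i + 1) j + c (i + 1) (j + 1)) =
      k (i + 1) j * (c (i + 1) j + c (i + 1) (j + 1))) :
    ∑ t ∈ Finset.range (R + R), k (t - R) 0 * (c (t - R) 0 + c (t - R + 1) 0) = 0 := by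
  have hc0 : ∀ i j : ℤ, ¬ ((-R < i ∧ i < R) ∧ (-R < j ∧ j < R)) → c i j = 0 := by
    intro i j h
    by_contra hne
    exact h (hc i j hne)
  set S : ℤ → ZMod 2 := fun j =>
    ∑ t ∈ Finset.range (R + R), k (t - R) j * (c (t - R) j + c (t - R + 1) j) with hS
  have hstep : ∀ j, S j = S (j + 1) := by
    intro j
    rw [← CharTwo.add_eq_zero, hS]
    simp only
    rw [← Finset.sum_add_distrib]
    set u : ℕ → ZMod 2 := fun t => k (t - R) j * (c (t - R) j + c (t - R) (j + 1)) with hu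
    -- By `hh` both horizontal edges of a face carry the weight `k` of that face. Modulo 2 they sum
    -- to its two vertical edges, and by `hv` each vertical edge has the same weight seen from
    -- either side, so the row telescopes.
    have h1 : ∀ t ∈ Finset.range (R + R), k (t - R) j * (c (t - R) j + c (t - R + 1) j) +
        k (t - R) (j + 1) * (c (t - R) (j + 1) + c (t - R + 1) (j + 1)) = u (t + 1) - u t := by
      intro t _
      have h2 := hv (t - R) j
      rw [← hh, hu]
      simp only
      rw [CharTwo.sub_eq_add (R := ZMod 2), show ((t + 1 : ℕ) : ℤ) - R = t - R + 1 by push_cast; ring,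
        ← h2]
      ring
    rw [Finset.sum_congr rfl h1, Finset.sum_range_sub, hu]
    simp only
    rw [hc0 _ _ (by push_cast; omega), hc0 _ _ (by push_cast; omega), hc0 _ _ (by push_cast; omega),
      hc0 _ _ (by push_cast; omega)]
    simp
  have hall : ∀ n : ℕ, S 0 = S n := by
    intro n
    induction n with
    | zero => rfl
    | succ n ih => rw [ih, hstep n]; push_cast; rfl
  change S 0 = 0
  rw [hall R, hS]
  refine Finset.sum_eq_zero fun t _ => ?_
  rw [hc0 _ _ (by omega), hc0 _ _ (by omega)]
  simp

/-- The dual lattice restricted to the edges that cross the boundary of `C`. -/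
def contourGraph (C : Set (ℤ × ℤ)) : SimpleGraph (ℤ × ℤ) where
  Adj a b := squareLattice.Adj a b ∧ ∃ u v, dualEdge s(a, b) = s(u, v) ∧ u ∈ C ∧ v ∉ C
  symm := ⟨fun a b h => by rw [Sym2.eq_swap]; exact ⟨h.1.symm, h.2⟩⟩
  loopless := ⟨fun a h => squareLattice.loopless.irrefl a h.1⟩

lemma natAbs_sub_le_length {C : Set (ℤ × ℤ)} {a b : ℤ × ℤ} (w : (contourGraph C).Walk a b) :
    |a.1 - b.1| ≤ w.length := by
  induction w with
  | nil => simp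
  | cons h w ih =>
    have := h.1
    rw [squareLattice_adj] at this
    rw [SimpleGraph.Walk.length_cons]
    push_cast
    grind

/-- Around a finite set containing the origin there is a long dual path crossing its boundary. -/
lemma exists_contour_path {C : Set (ℤ × ℤ)} (hC : C.Finite) (h0 : (0, 0) ∈ C) :
    ∃ n : ℕ, ∃ v, ∃ w : squareLattice.Walk ((n : ℤ), 0) v, w.IsPath ∧ w.length = n + 1 ∧
      ∀ e ∈ w.edges, ∃ a b, dualEdge e = s(a, b) ∧ a ∈ C ∧ b ∉ C := by
  classical
  obtain ⟨R, hR⟩ : ∃ R : ℕ, ∀ x ∈ C, (-R < x.1 ∧ x.1 < R) ∧ (-R < x.2 ∧ x.2 < R) := by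
    obtain ⟨R, hR⟩ := (hC.image supNorm).bddAbove
    refine ⟨R + 1, fun x hx => ?_⟩
    have : supNorm x ≤ R := hR (mem_image_of_mem _ hx)
    simp only [supNorm] at this
    push_cast
    omega
  set c : ℤ → ℤ → ZMod 2 := fun i j => if (i, j) ∈ C then 1 else 0 with hc
  -- The contour components of the faces above the boundary edges of `C` on the nonnegative
  -- horizontal axis. Parity replaces any planar topology: on that half-axis the weighted boundary
  -- count is odd, while the count over the whole axis is even, so some component also reaches a
  -- face to the left of the origin.
  set K : Set (ℤ × ℤ) := {b | ∃ n : ℕ, c n 0 + c (n + 1) 0 ≠ 0 ∧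
    (contourGraph C).Reachable ((n : ℤ), 0) b} with hK
  set k : ℤ → ℤ → ZMod 2 := fun i j => if (i, j) ∈ K then 1 else 0 with hk
  have hbd : ∀ u v : ℤ × ℤ, c u.1 u.2 + c v.1 v.2 ≠ 0 →
      ∃ a b, s(u, v) = s(a, b) ∧ a ∈ C ∧ b ∉ C := by
    intro u v h
    by_cases hu : u ∈ C <;> by_cases hv : v ∈ C <;> simp only [hc, hu, hv, if_true, if_false] at h
    · exact absurd (by decide) h
    · exact ⟨u, v, rfl, hu, hv⟩
    · exact ⟨v, u, Sym2.eq_swap, hv, hu⟩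
    · exact absurd (by decide) h
  have hkk : ∀ a b : ℤ × ℤ, (contourGraph C).Adj a b → k a.1 a.2 = k b.1 b.2 := by
    intro a b hab
    have : a ∈ K ↔ b ∈ K :=
      ⟨fun ⟨n, h1, h2⟩ => ⟨n, h1, h2.trans hab.reachable⟩,
        fun ⟨n, h1, h2⟩ => ⟨n, h1, h2.trans hab.symm.reachable⟩⟩
    simp only [hk, this]
  have hsum := parity_row_sum (c := c) (k := k) (R := R) ?_ ?_ ?_
  · rw [Finset.sum_range_add] at hsum
    set u : ℕ → ZMod 2 := fun t => c t 0 with hu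
    have h2 : ∑ t ∈ Finset.range R, k ((R + t : ℕ) - R) 0 *
        (c ((R + t : ℕ) - R) 0 + c ((R + t : ℕ) - R + 1) 0) = 1 := by
      have h3 : ∀ t ∈ Finset.range R, k ((R + t : ℕ) - R) 0 *
          (c ((R + t : ℕ) - R) 0 + c ((R + t : ℕ) - R + 1) 0) =
          u (t + 1) - u t := by
        intro t _
        rw [show ((R + t : ℕ) : ℤ) - R = t by push_cast; ring]
        simp only [hu]
        rw [CharTwo.sub_eq_add (R := ZMod 2)]
        push_cast
        by_cases h4 : c t 0 + c (t + 1) 0 = 0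
        · rw [h4, add_comm, h4, mul_zero]
        · have : k t 0 = 1 := if_pos ⟨t, h4, SimpleGraph.Reachable.refl _⟩
          rw [this, one_mul, add_comm]
      rw [Finset.sum_congr rfl h3, Finset.sum_range_sub]
      have h5 : u 0 = 1 := if_pos h0
      have h6 : u R = 0 := if_neg fun h => by have := (hR _ h).1.2; simp at this
      rw [h5, h6]
      decide
    rw [h2] at hsum
    have h7 : ∑ t ∈ Finset.range R, k (t - R) 0 * (c (t - R) 0 + c (t - R + 1) 0) ≠ 0 := by
      intro h8
      rw [h8] at hsum
      exact absurd hsum (by decide)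
    obtain ⟨t, ht, hne⟩ := Finset.exists_ne_zero_of_sum_ne_zero h7
    have hmem : ((t : ℤ) - R, (0 : ℤ)) ∈ K := by
      by_contra h8
      exact hne (by simp only [hk, h8, if_false, zero_mul])
    obtain ⟨n, -, hr⟩ := hmem
    obtain ⟨w, hw⟩ := hr.exists_isPath
    -- The path goes from abscissa `n ≥ 0` to a negative abscissa and changes it by at most 1 per
    -- step.
    have hlen : n + 1 ≤ w.length := by
      have := natAbs_sub_le_length w
      simp only [Finset.mem_range] at ht this
      have h9 := (le_abs_self _).trans this
      omega
    have hle : contourGraph C ≤ squareLattice := fun _ _ h => h.1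
    refine ⟨n, _, (w.take (n + 1)).mapLe hle, (hw.take _).mapLe hle, ?_, ?_⟩
    · simp [SimpleGraph.Walk.take_length, hlen]
    · intro e he
      rw [SimpleGraph.Walk.edges_mapLe_eq_edges] at he
      have := (w.take (n + 1)).edges_subset_edgeSet he
      induction e with
      | h a b => exact this.2
  · intro i j h
    exact hR (i, j) (by by_contra h'; exact h (if_neg h'))
  · intro i j
    by_cases h : c i (j + 1) + c (i + 1) (j + 1) = 0
    · rw [h, mul_zero, mul_zero]
    · congr 1
      refine hkk (i, j) (i, j + 1) ⟨by rw [squareLattice_adj]; simp, ?_⟩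
      obtain ⟨a, b, h1, h2⟩ := hbd (i, j + 1) (i + 1, j + 1) h
      exact ⟨a, b, by rw [← h1, dualEdge_mk]; simp, h2⟩
  · intro i j
    by_cases h : c (i + 1) j + c (i + 1) (j + 1) = 0
    · rw [h, mul_zero, mul_zero]
    · congr 1
      refine hkk (i, j) (i + 1, j) ⟨by rw [squareLattice_adj]; simp, ?_⟩
      obtain ⟨a, b, h1, h2⟩ := hbd (i + 1, j) (i + 1, j + 1) h
      exact ⟨a, b, by rw [← h1, dualEdge_mk]; simp, h2⟩

/-- The Peierls bound: a random set containing the origin, all of whose boundary edges are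
`closed`, is unlikely to be finite. -/
lemma peierls {Ω : Type*} [MeasurableSpace Ω] (μ : Measure Ω) (A : Sym2 (ℤ × ℤ) → Set Ω)
    {q : ℝ≥0∞} (hA : ∀ s : Finset (Sym2 (ℤ × ℤ)), ↑s ⊆ squareLattice.edgeSet →
      μ {ω | ∀ e ∈ s, ω ∈ A e} ≤ q ^ s.card) (C : Ω → Set (ℤ × ℤ)) (h0 : ∀ ω, (0, 0) ∈ C ω)
    (hC : ∀ ω u v, u ∈ C ω → v ∉ C ω → squareLattice.Adj u v → ω ∈ A s(u, v)) :
    μ {ω | (C ω).Finite} ≤ ∑' n : ℕ, (4 * q) ^ (n + 1) := by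
  classical
  calc _ ≤ μ (⋃ n : ℕ, {ω | ∃ v, ∃ w : squareLattice.Walk ((n : ℤ), 0) v, w.IsPath ∧
        w.length = n + 1 ∧ ∀ e ∈ w.edges, ω ∈ A (dualEdge e)}) := by
        refine measure_mono fun ω hω => ?_
        obtain ⟨n, v, w, h1, h2, h3⟩ := exists_contour_path hω (h0 ω)
        refine mem_iUnion.2 ⟨n, v, w, h1, h2, fun e he => ?_⟩
        obtain ⟨a, b, h4, h5, h6⟩ := h3 e he
        have h7 := dualEdge_mem (w.edges_subset_edgeSet he)
        rw [h4] at h7 ⊢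
        exact hC ω a b h5 h6 h7
    _ ≤ ∑' n : ℕ, _ := measure_iUnion_le _
    _ ≤ _ := by
        refine ENNReal.tsum_le_tsum fun n => ?_
        refine measure_exists_path_le μ squareLattice (D := 4)
          (fun x => squareLattice_degree_le x) (fun e => A (dualEdge e)) (fun s hs => ?_) (n + 1) _
        have h1 := hA (s.image dualEdge) (by
          intro e he
          obtain ⟨e', he', rfl⟩ := Finset.mem_image.1 (Finset.mem_coe.1 he)
          exact dualEdge_mem (hs he'))
        rw [Finset.card_image_of_injOn (dualEdge_injOn.mono hs)] at h1
        simpa using h1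

/-! ### A transient tree of polynomial growth -/

/-- The number of vertices at distance `n` from the root. -/
def levelSize (n : ℕ) : ℕ := 2 ^ (4 * Nat.log 2 (n + 1))

lemma levelSize_pos (n : ℕ) : 0 < levelSize n := by
  unfold levelSize; positivity

lemma levelSize_zero : levelSize 0 = 1 := by simp [levelSize]

lemma levelSize_dvd {m n : ℕ} (h : m ≤ n) : levelSize m ∣ levelSize n :=
  pow_dvd_pow _ (Nat.mul_le_mul_left _ (Nat.log_mono_right (by omega)))

lemma levelSize_succ_le (n : ℕ) : levelSize (n + 1) ≤ 16 * levelSize n := by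
  have h : Nat.log 2 (n + 1 + 1) ≤ Nat.log 2 (n + 1) + 1 := by
    rw [← Nat.log_mul_base (by norm_num) (by omega)]
    exact Nat.log_mono_right (by omega)
  calc levelSize (n + 1) ≤ 2 ^ (4 * (Nat.log 2 (n + 1) + 1)) :=
        Nat.pow_le_pow_right (by norm_num) (by omega)
    _ = _ := by rw [mul_add, pow_add, levelSize]; ring

lemma levelSize_le (n : ℕ) : levelSize n ≤ (n + 1) ^ 4 := by
  rw [levelSize, mul_comm, pow_mul]
  exact Nat.pow_le_pow_left (Nat.pow_log_le_self 2 (by omega)) 4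

lemma le_levelSize (n : ℕ) : ((n : ℝ) + 1) ^ 4 / 16 ≤ levelSize n := by
  have h : n + 1 < 2 ^ (Nat.log 2 (n + 1) + 1) := Nat.lt_pow_succ_log_self (by norm_num) _
  have h' : ((n : ℝ) + 1) ≤ 2 * 2 ^ Nat.log 2 (n + 1) := by
    have : ((n + 1 : ℕ) : ℝ) ≤ ((2 ^ (Nat.log 2 (n + 1) + 1) : ℕ) : ℝ) := by exact_mod_cast h.le
    push_cast at this
    rw [pow_succ] at this
    linarith
  rw [levelSize, mul_comm 4, pow_mul]
  push_cast
  rw [div_le_iff₀ (by norm_num)]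
  calc ((n : ℝ) + 1) ^ 4 ≤ (2 * 2 ^ Nat.log 2 (n + 1)) ^ 4 := by gcongr
    _ = _ := by ring

/-- The vertices of the tree: `(n, i)` is the `i`-th vertex of level `n`. -/
abbrev TreeVertex : Type := {x : ℕ × ℕ // x.2 < levelSize x.1}

/-- The ancestor at level `m` of the vertices with index `j`. -/
def ancestor (m j : ℕ) : TreeVertex := ⟨(m, j % levelSize m), Nat.mod_lt _ (levelSize_pos m)⟩

/-- `x` is the parent of `y`. -/
def IsParent (x y : TreeVertex) : Prop :=
  y.1.1 = x.1.1 + 1 ∧ y.1.2 % levelSize x.1.1 = x.1.2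

/-- The spherically symmetric tree with level sizes `levelSize`. -/
def polyTree : SimpleGraph TreeVertex where
  Adj x y := IsParent x y ∨ IsParent y x
  symm := ⟨fun _ _ h => h.symm⟩
  loopless := ⟨fun x h => by rcases h with h | h <;> exact absurd h.1 (by omega)⟩

/-- The root of the tree. -/
def treeRoot : TreeVertex := ancestor 0 0

lemma isParent_ancestor (m j : ℕ) : IsParent (ancestor m j) (ancestor (m + 1) j) :=
  ⟨rfl, Nat.mod_mod_of_dvd _ (levelSize_dvd (Nat.le_succ m))⟩

lemma ancestor_self (x : TreeVertex) : ancestor x.1.1 x.1.2 = x :=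
  Subtype.ext (Prod.ext rfl (Nat.mod_eq_of_lt x.2))

lemma IsParent.eq_ancestor {x : TreeVertex} {m j : ℕ} (h : IsParent x (ancestor (m + 1) j)) :
    x = ancestor m j := by
  obtain ⟨⟨a, b⟩, hx⟩ := x
  obtain ⟨h1, h2⟩ := h
  have h3 : m = a := by simpa [ancestor] using h1
  subst h3
  refine Subtype.ext (Prod.ext rfl ?_)
  simp only at h2 ⊢
  rw [← h2]
  exact (Nat.mod_mod_of_dvd _ (levelSize_dvd (Nat.le_succ m)))

/-- The descendants of `v`. -/
def descendants (v : TreeVertex) : Set TreeVertex :=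
  {w | v.1.1 ≤ w.1.1 ∧ w.1.2 % levelSize v.1.1 = v.1.2}

lemma self_mem_descendants (v : TreeVertex) : v ∈ descendants v :=
  ⟨le_rfl, Nat.mod_eq_of_lt v.2⟩

lemma mem_descendants_of_isParent {x y v : TreeVertex} (h : IsParent x y) (hy : y ≠ v) :
    x ∈ descendants v ↔ y ∈ descendants v := by
  obtain ⟨h1, h2⟩ := h
  rcases lt_trichotomy y.1.1 v.1.1 with hlt | heq | hgt
  · exact ⟨fun h => by have := h.1; omega, fun h => by have := h.1; omega⟩
  · refine ⟨fun h => by have := h.1; omega, fun h => absurd ?_ hy⟩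
    refine Subtype.ext (Prod.ext heq ?_)
    rw [← h.2, ← heq, Nat.mod_eq_of_lt y.2]
  · have h3 : x.1.2 % levelSize v.1.1 = y.1.2 % levelSize v.1.1 := by
      rw [← h2, Nat.mod_mod_of_dvd _ (levelSize_dvd (by omega))]
    simp only [descendants, Set.mem_ofPred_eq, h3]
    exact ⟨fun h => ⟨by omega, h.2⟩, fun h => ⟨by omega, h.2⟩⟩

lemma enter_descendants {x y v : TreeVertex} (h : polyTree.Adj x y) (hx : x ∉ descendants v)
    (hy : y ∈ descendants v) : y = v ∧ IsParent x v := by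
  rcases h with h | h
  · by_cases hyv : y = v
    · exact ⟨hyv, hyv ▸ h⟩
    · exact absurd ((mem_descendants_of_isParent h hyv).2 hy) hx
  · by_cases hxv : x = v
    · exact absurd (hxv ▸ self_mem_descendants v) hx
    · exact absurd ((mem_descendants_of_isParent h hxv).1 hy) hx

/-! ### Cuts and bridges -/

lemma exists_crossing {G : SimpleGraph V} {D : Set V} {x y : V} (h : G.Reachable x y)
    (hx : x ∉ D) (hy : y ∈ D) : ∃ a b, G.Adj a b ∧ a ∉ D ∧ b ∈ D := by
  obtain ⟨w⟩ := h
  induction w with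
  | nil => exact absurd hy hx
  | cons ha w ih =>
    rename_i a b c
    by_cases hb : b ∈ D
    · exact ⟨a, b, ha, hx, hb⟩
    · exact ih hb hy

lemma isBridge_of_cut {G : SimpleGraph V} {D : Set V} {u v : V} (hu : u ∉ D) (hv : v ∈ D)
    (h : ∀ x y, G.Adj x y → x ∉ D → y ∈ D → x = u ∧ y = v) : G.IsBridge s(u, v) := by
  rw [SimpleGraph.isBridge_iff]
  intro hr
  obtain ⟨a, b, hab, ha, hb⟩ := exists_crossing hr hu hv
  rw [SimpleGraph.deleteEdges_adj] at hab
  obtain ⟨rfl, rfl⟩ := h a b hab.1 ha hb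
  exact hab.2 rfl

lemma IsParent.notMem_descendants {x y : TreeVertex} (h : IsParent x y) : x ∉ descendants y :=
  fun hx => by have := hx.1; have := h.1; omega

lemma IsParent.unique {x x' y : TreeVertex} (h : IsParent x y) (h' : IsParent x' y) : x = x' := by
  have h1 : x.1.1 = x'.1.1 := by have := h.1; have := h'.1; omega
  exact Subtype.ext (Prod.ext h1 (by rw [← h.2, ← h'.2, h1]))

lemma polyTree_connected : polyTree.Connected := by
  have h : ∀ m j, polyTree.Reachable treeRoot (ancestor m j) := by
    intro m j
    induction m with
    | zero =>
      have : treeRoot = ancestor 0 j :=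
        Subtype.ext (Prod.ext rfl (by simp [treeRoot, ancestor, levelSize_zero, Nat.mod_one]))
      rw [this]
    | succ m ih => exact ih.trans (SimpleGraph.Adj.reachable (Or.inl (isParent_ancestor m j)))
  have h' : ∀ x, polyTree.Reachable treeRoot x := fun x => ancestor_self x ▸ h _ _
  exact { preconnected := fun x y => (h' x).symm.trans (h' y), nonempty := ⟨treeRoot⟩ }

lemma polyTree_isBridge {x y : TreeVertex} (h : IsParent x y) : polyTree.IsBridge s(x, y) :=
  isBridge_of_cut h.notMem_descendants (self_mem_descendants y) fun a b hab ha hb => by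
    obtain ⟨rfl, h2⟩ := enter_descendants hab ha hb
    exact ⟨h2.unique h, rfl⟩

lemma polyTree_isTree : polyTree.IsTree := by
  refine ⟨polyTree_connected, SimpleGraph.isAcyclic_iff_forall_isBridge.2 fun e he => ?_⟩
  induction e with
  | h x y =>
    rcases he with h | h
    · exact polyTree_isBridge h
    · rw [Sym2.eq_swap]; exact polyTree_isBridge h

/-- One parent and at most 16 children, since the level size grows by a factor of at most 16. -/
lemma polyTree_degree_le (x : TreeVertex) : (polyTree.neighborSet x).encard ≤ 17 := by
  classical
  rw [← (Subtype.val_injective.injOn (s := polyTree.neighborSet x)).encard_image]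
  set P : Finset (ℕ × ℕ) := {(x.1.1 - 1, x.1.2 % levelSize (x.1.1 - 1))} ∪
    (Finset.range 16).image fun t => (x.1.1 + 1, x.1.2 + levelSize x.1.1 * t) with hP
  have hsub : Subtype.val '' polyTree.neighborSet x ⊆ (P : Set (ℕ × ℕ)) := by
    rintro _ ⟨y, hy, rfl⟩
    rw [hP]
    simp only [Finset.coe_union, Finset.coe_singleton, Finset.coe_image, Set.mem_union,
      Set.mem_singleton_iff, Set.mem_image, Finset.coe_range, mem_Iio]
    rcases hy with h | h
    · right
      refine ⟨y.1.2 / levelSize x.1.1, ?_, Prod.ext h.1.symm ?_⟩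
      · rw [Nat.div_lt_iff_lt_mul (levelSize_pos _)]
        exact y.2.trans_le (h.1 ▸ levelSize_succ_le _)
      · simp only
        rw [← h.2, Nat.mod_add_div]
    · left
      have h1 : x.1.1 - 1 = y.1.1 := by have := h.1; omega
      rw [h1]
      exact Prod.ext rfl h.2.symm
  refine (Set.encard_le_encard hsub).trans ?_
  rw [Set.encard_coe_eq_coe_finsetCard]
  have : P.card ≤ 1 + 16 := (Finset.card_union_le _ _).trans
    (add_le_add (by simp) (Finset.card_image_le.trans (by simp)))
  exact_mod_cast this

lemma polyTree_locFinite : LocFinite polyTree :=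
  fun x => Set.finite_of_encard_le_coe (k := 17) (polyTree_degree_le x)

/-! ### Level averages and transience of the tree -/

lemma sum_range_mul_mod (c s : ℕ) (f : ℕ → ℝ) :
    ∑ i ∈ Finset.range (c * s), f (i % s) = c * ∑ i ∈ Finset.range s, f i := by
  induction c with
  | zero => simp
  | succ c ih =>
    rw [add_mul, one_mul, Finset.sum_range_add, ih]
    have : ∑ x ∈ Finset.range s, f ((c * s + x) % s) = ∑ x ∈ Finset.range s, f x := by
      refine Finset.sum_congr rfl fun x hx => ?_
      rw [mul_comm, Nat.mul_add_mod, Nat.mod_eq_of_lt (Finset.mem_range.1 hx)]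
    rw [this]
    push_cast
    ring

/-- The average of `f` over a level of the tree. -/
def levelAvg (f : TreeVertex → ℝ) (n : ℕ) : ℝ :=
  (∑ i ∈ Finset.range (levelSize n), f (ancestor n i)) / levelSize n

/-- All vertices of level `n` have equally many children, so the difference of averages is the mean
increment over the edges between the two levels. Cauchy–Schwarz then bounds it by the energy. -/
lemma levelAvg_sub_sq_le (f : TreeVertex → ℝ) (n : ℕ) (hE : energy polyTree f ≠ ∞) :
    (levelAvg f n - levelAvg f (n + 1)) ^ 2 * levelSize (n + 1) ≤ (energy polyTree f).toReal := by
  obtain ⟨c, hc⟩ := levelSize_dvd (Nat.le_succ n)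
  have hs := levelSize_pos n
  have hs' := levelSize_pos (n + 1)
  have hc0 : (c : ℝ) ≠ 0 := by
    rintro h
    rw [Nat.cast_eq_zero] at h
    rw [h, mul_zero] at hc
    exact hs'.ne' hc
  have hS : (0 : ℝ) < levelSize n := by exact_mod_cast hs
  have hS' : (0 : ℝ) < levelSize (n + 1) := by exact_mod_cast hs'
  have h1 : ∑ i ∈ Finset.range (levelSize (n + 1)), f (ancestor n i) =
      c * ∑ i ∈ Finset.range (levelSize n), f (ancestor n i) := by
    rw [← sum_range_mul_mod c (levelSize n) fun i => f (ancestor n i), mul_comm c, ← hc]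
    refine Finset.sum_congr rfl fun i _ => ?_
    congr 1
    exact Subtype.ext (Prod.ext rfl (Nat.mod_mod _ _).symm)
  have h2 : levelAvg f n = (∑ i ∈ Finset.range (levelSize (n + 1)), f (ancestor n i)) /
      levelSize (n + 1) := by
    rw [h1, hc, levelAvg]
    push_cast
    field_simp
  have h3 : (levelAvg f n - levelAvg f (n + 1)) * levelSize (n + 1) =
      ∑ i ∈ Finset.range (levelSize (n + 1)),
        (f (ancestor n i) - f (ancestor (n + 1) i)) := by
    rw [h2, levelAvg, ← sub_div, div_mul_cancel₀ _ hS'.ne', Finset.sum_sub_distrib]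
  have h4 : ∑ i ∈ Finset.range (levelSize (n + 1)),
      (f (ancestor n i) - f (ancestor (n + 1) i)) ^ 2 ≤ (energy polyTree f).toReal := by
    rw [← ENNReal.ofReal_le_iff_le_toReal hE]
    refine sum_sq_le_energy (fun i hi j hj hij => ?_) (fun i _ => Or.inl (isParent_ancestor n i)) f
    simp only [Finset.coe_range, mem_Iio] at hi hj
    have h5 := congrArg (fun p : TreeVertex × TreeVertex => p.2.1.2) hij
    simpa [ancestor, Nat.mod_eq_of_lt hi, Nat.mod_eq_of_lt hj] using h5
  have h6 := sq_sum_le_card_mul_sum_sq (s := Finset.range (levelSize (n + 1)))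
    (f := fun i => f (ancestor n i) - f (ancestor (n + 1) i))
  rw [← h3, Finset.card_range, mul_pow] at h6
  refine le_trans ?_ h4
  refine le_of_mul_le_mul_right ?_ hS'
  calc _ = (levelAvg f n - levelAvg f (n + 1)) ^ 2 * (levelSize (n + 1) : ℝ) ^ 2 := by ring
    _ ≤ _ := h6
    _ = _ := by ring

lemma polyTree_capPos : CapPos polyTree treeRoot := by
  refine ⟨16, fun f hf => ?_⟩
  by_cases hE : energy polyTree f = ∞
  · rw [hE]; simp
  set E := (energy polyTree f).toReal with hEdef
  have hE0 : 0 ≤ E := ENNReal.toReal_nonneg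
  have hstep : ∀ n, |levelAvg f n - levelAvg f (n + 1)| ≤ √E * (4 / ((n : ℝ) + 2) ^ 2) := by
    intro n
    rw [← Real.sqrt_sq (show 0 ≤ 4 / ((n : ℝ) + 2) ^ 2 by positivity), ← Real.sqrt_mul hE0]
    refine Real.abs_le_sqrt ?_
    have h1 := levelAvg_sub_sq_le f n hE
    have h2 := le_levelSize (n + 1)
    push_cast at h2
    have h3 : (levelAvg f n - levelAvg f (n + 1)) ^ 2 * (((n : ℝ) + 1 + 1) ^ 4 / 16) ≤ E :=
      (mul_le_mul_of_nonneg_left h2 (sq_nonneg _)).trans h1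
    rw [div_pow, mul_div_assoc', le_div_iff₀ (by positivity)]
    calc _ = ((levelAvg f n - levelAvg f (n + 1)) ^ 2 * (((n : ℝ) + 1 + 1) ^ 4 / 16)) * 16 := by
          ring
      _ ≤ E * 16 := by gcongr
      _ = _ := by norm_num
  -- The increments are dominated by the telescoping differences of `1 / (N + 1)`. The total is at
  -- most `4 * √E`, hence the capacity constant 16.
  have hsum : ∀ N : ℕ, |levelAvg f 0 - levelAvg f N| ≤ √E * (4 * (1 - 1 / ((N : ℝ) + 1))) := by
    intro N
    induction N with
    | zero => simp
    | succ N ih =>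
      calc |levelAvg f 0 - levelAvg f (N + 1)|
          ≤ |levelAvg f 0 - levelAvg f N| + |levelAvg f N - levelAvg f (N + 1)| := abs_sub_le _ _ _
        _ ≤ √E * (4 * (1 - 1 / ((N : ℝ) + 1))) + √E * (4 / ((N : ℝ) + 2) ^ 2) :=
            add_le_add ih (hstep N)
        _ = √E * (4 * (1 - 1 / ((N : ℝ) + 1)) + 4 / ((N : ℝ) + 2) ^ 2) := by ring
        _ ≤ _ := by
            refine mul_le_mul_of_nonneg_left ?_ (Real.sqrt_nonneg _)
            have h1 : 1 / ((N : ℝ) + 2) ^ 2 ≤ 1 / ((N : ℝ) + 1) - 1 / ((N : ℝ) + 2) := by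
              rw [div_sub_div _ _ (by positivity) (by positivity),
                div_le_div_iff₀ (by positivity) (by positivity)]
              nlinarith [(Nat.cast_nonneg N : (0 : ℝ) ≤ N)]
            have h2 : (4 : ℝ) / ((N : ℝ) + 2) ^ 2 = 4 * (1 / ((N : ℝ) + 2) ^ 2) := by ring
            push_cast
            rw [show (N : ℝ) + 1 + 1 = N + 2 by ring, h2]
            linarith
  obtain ⟨N, hN⟩ : ∃ N, levelAvg f N = 0 := by
    obtain ⟨N, hN⟩ := (hf.image fun x => x.1.1).bddAbove
    refine ⟨N + 1, ?_⟩
    rw [levelAvg, Finset.sum_eq_zero, zero_div]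
    intro i _
    by_contra hne
    have : N + 1 ≤ N := hN (mem_image_of_mem (fun x : TreeVertex => x.1.1)
      (show ancestor (N + 1) i ∈ f.support from hne))
    omega
  have h0 : levelAvg f 0 = f treeRoot := by simp [levelAvg, levelSize_zero, treeRoot]
  have h1 := hsum N
  rw [hN, h0, sub_zero] at h1
  have h2 : |f treeRoot| ≤ √E * 4 := by
    refine h1.trans (mul_le_mul_of_nonneg_left ?_ (Real.sqrt_nonneg _))
    have : 0 ≤ 1 / ((N : ℝ) + 1) := by positivity
    linarith
  have h3 : f treeRoot ^ 2 ≤ 16 * E := by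
    rw [← sq_abs]
    calc |f treeRoot| ^ 2 ≤ (√E * 4) ^ 2 := by gcongr
      _ = 16 * (√E) ^ 2 := by ring
      _ = _ := by rw [Real.sq_sqrt hE0]
  rw [← ENNReal.ofReal_toReal hE, ← ENNReal.ofReal_coe_nnreal, ← ENNReal.ofReal_mul (by simp)]
  exact ENNReal.ofReal_le_ofReal (by simpa using h3)

/-- A random subset of the edges of the tree that contains a given set of `n` edges with
probability at most `q ^ n`, where `q < 1`, has finite clusters. -/
lemma polyTree_measure_cluster_infinite {Ω : Type*} [MeasurableSpace Ω] (μ : Measure Ω)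
    (S : Ω → Set (Sym2 TreeVertex)) {q : ℝ} (hq0 : 0 ≤ q) (hq1 : q < 1)
    (hS : ∀ s : Finset (Sym2 TreeVertex), ↑s ⊆ polyTree.edgeSet →
      μ {ω | ↑s ⊆ S ω} ≤ ENNReal.ofReal q ^ s.card) (y : TreeVertex) :
    μ {ω | (cluster polyTree (S ω) y).Infinite} = 0 := by
  classical
  set d := y.1.1 with hd
  set edges : ℕ → ℕ → Finset (Sym2 TreeVertex) := fun n j =>
    (Finset.range n).image fun m => s(ancestor (d + m) j, ancestor (d + m + 1) j) with hedges
  have hcard : ∀ n j, (edges n j).card = n := by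
    intro n j
    rw [hedges, Finset.card_image_of_injective, Finset.card_range]
    intro m m' h
    simp only [Sym2.eq_iff, ancestor, Subtype.mk.injEq, Prod.mk.injEq] at h
    omega
  have hbound : ∀ n, μ {ω | (cluster polyTree (S ω) y).Infinite} ≤
      ENNReal.ofReal (((d + n + 1 : ℕ) : ℝ) ^ 4 * q ^ n) := by
    intro n
    calc _ ≤ μ (⋃ j ∈ Finset.range (levelSize (d + n)), {ω | ↑(edges n j) ⊆ S ω}) := by
          refine measure_mono fun ω hω => ?_
          obtain ⟨w, hw, hlev⟩ : ∃ w ∈ cluster polyTree (S ω) y, d + n ≤ w.1.1 := by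
            by_contra hcon
            push Not at hcon
            refine hω (((Finset.range (d + n)).finite_toSet.biUnion fun m _ =>
              ((Finset.range (levelSize m)).image (ancestor m)).finite_toSet).subset ?_)
            intro w hw
            refine mem_biUnion (x := w.1.1) (by simpa using hcon w hw) ?_
            simp only [Finset.coe_image, Finset.coe_range, Set.mem_image, mem_Iio]
            exact ⟨w.1.2, w.2, ancestor_self w⟩
          simp only [mem_iUnion, Finset.mem_range]
          refine ⟨w.1.2 % levelSize (d + n), Nat.mod_lt _ (levelSize_pos _), ?_⟩
          intro e he
          simp only [hedges, Finset.coe_image, Finset.coe_range, Set.mem_image, mem_Iio] at he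
          obtain ⟨m, hm, rfl⟩ := he
          have hanc : ∀ k ≤ d + n, ancestor k (w.1.2 % levelSize (d + n)) = ancestor k w.1.2 :=
            fun k hk => Subtype.ext (Prod.ext rfl (Nat.mod_mod_of_dvd _ (levelSize_dvd hk)))
          rw [hanc _ (by omega), hanc _ (by omega)]
          -- The open path from `y` to `w` enters the descendants of each ancestor of `w` below
          -- level `d`, and the only way in is the edge from that ancestor's parent. So those edges
          -- are open, even if `w` does not descend from `y`.
          obtain ⟨a, b, hab, ha, hb⟩ := exists_crossing
            (D := descendants (ancestor (d + m + 1) w.1.2)) hw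
            (fun h => by have h1 : d + m + 1 ≤ y.1.1 := h.1; omega)
            ⟨show d + m + 1 ≤ w.1.1 by omega, rfl⟩
          obtain ⟨rfl, h2⟩ := enter_descendants hab.1 ha hb
          rw [← h2.eq_ancestor]
          exact hab.2
      _ ≤ ∑ j ∈ Finset.range (levelSize (d + n)), μ {ω | ↑(edges n j) ⊆ S ω} :=
          measure_biUnion_finset_le _ _
      _ ≤ ∑ j ∈ Finset.range (levelSize (d + n)), ENNReal.ofReal q ^ n := by
          refine Finset.sum_le_sum fun j _ => ?_
          refine (hS _ ?_).trans (le_of_eq (by rw [hcard]))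
          intro e he
          simp only [hedges, Finset.coe_image, Finset.coe_range, Set.mem_image, mem_Iio] at he
          obtain ⟨m, -, rfl⟩ := he
          exact Or.inl (isParent_ancestor _ _)
      _ = ENNReal.ofReal (levelSize (d + n) * q ^ n) := by
          rw [Finset.sum_const, Finset.card_range, nsmul_eq_mul,
            ENNReal.ofReal_mul (by positivity), ENNReal.ofReal_pow hq0, ENNReal.ofReal_natCast]
      _ ≤ _ := by
          refine ENNReal.ofReal_le_ofReal ?_
          gcongr
          exact_mod_cast levelSize_le (d + n)
  have hlim : Filter.Tendsto (fun n : ℕ => ((d + n + 1 : ℕ) : ℝ) ^ 4 * q ^ n) Filter.atTop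
      (nhds 0) := by
    have h1 := (tendsto_pow_const_mul_const_pow_of_abs_lt_one 4
      (abs_lt.2 ⟨by linarith, hq1⟩)).const_mul ((d + 2 : ℝ) ^ 4)
    rw [mul_zero] at h1
    refine squeeze_zero' (Filter.Eventually.of_forall fun n => by positivity) ?_ h1
    filter_upwards [Filter.eventually_ge_atTop 1] with n hn
    rw [← mul_assoc, ← mul_pow]
    gcongr
    have : (1 : ℝ) ≤ n := by exact_mod_cast hn
    push_cast
    nlinarith [(Nat.cast_nonneg d : (0 : ℝ) ≤ d)]
  have h2 := ENNReal.tendsto_ofReal hlim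
  rw [ENNReal.ofReal_zero] at h2
  exact le_antisymm (ge_of_tendsto' h2 hbound) zero_le

lemma polyTree_pc (v : TreeVertex) : pc polyTree v = 1 := by
  refine sInf_eq_top.2 fun p hp => ?_
  by_contra hne
  refine hp.2.ne' (polyTree_measure_cluster_infinite _ (fun ω => ω) p.2.1
    (lt_of_le_of_ne p.2.2 fun h => hne (Subtype.ext h)) (fun s hs => ?_) v)
  exact (setBernoulli_subset p hs).le

/-! ### The square lattice with the tree attached -/

/-- Converse comparison to `energy_comp_le`: every edge of `G` is the image of an edge of `X`, so no
energy is lost by restriction. -/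
lemma le_energy_comp {W : Type*} {X : SimpleGraph W} {G : SimpleGraph V} {φ : W → V}
    (hφ : Function.Injective φ)
    (h : ∀ u v, G.Adj u v → ∃ a b, X.Adj a b ∧ φ a = u ∧ φ b = v) (f : V → ℝ) :
    energy G f ≤ energy X (f ∘ φ) := by
  classical
  rw [energy, ← (hφ.prodMap hφ).tsum_eq]
  · refine ENNReal.tsum_le_tsum fun e => ?_
    by_cases h1 : G.Adj (φ e.1) (φ e.2)
    · obtain ⟨a, b, h2, h3, h4⟩ := h _ _ h1
      rw [hφ h3, hφ h4] at h2
      simp [h1, h2]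
    · simp [h1]
  · intro e he
    by_cases h1 : G.Adj e.1 e.2
    · obtain ⟨a, b, -, h3, h4⟩ := h _ _ h1
      exact ⟨(a, b), Prod.ext h3 h4⟩
    · exact absurd (by simp [h1]) he

lemma LocFinite.coe {G : SimpleGraph V} (h : LocFinite G) (H : G.Subgraph) : LocFinite H.coe := by
  intro v
  refine Set.Finite.subset ((h v).preimage Subtype.val_injective.injOn) fun w hw => ?_
  exact H.adj_sub hw

/-- The vertices of the square lattice with the tree attached at the origin. -/
abbrev GlueVertex : Type := {q : (ℤ × ℤ) × TreeVertex // q.1 = (0, 0) ∨ q.2 = treeRoot}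

/-- The square lattice with the tree attached at the origin. -/
abbrev glueGraph : SimpleGraph GlueVertex := attach squareLattice (0, 0) polyTree treeRoot

/-- The inclusion of the square lattice. -/
def ofLattice (u : ℤ × ℤ) : GlueVertex := ⟨(u, treeRoot), Or.inr rfl⟩

/-- The inclusion of the tree. -/
def ofTree (t : TreeVertex) : GlueVertex := ⟨((0, 0), t), Or.inl rfl⟩

/-- The vertex at which the two parts are glued. -/
def gluePoint : GlueVertex := ofLattice (0, 0)

lemma ofLattice_injective : Function.Injective ofLattice :=
  fun _ _ h => congrArg (fun q : GlueVertex => q.1.1) h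

lemma ofTree_injective : Function.Injective ofTree :=
  fun _ _ h => congrArg (fun q : GlueVertex => q.1.2) h

lemma ofLattice_of_eq {q : GlueVertex} (h : q.1.2 = treeRoot) : ofLattice q.1.1 = q :=
  Subtype.ext (Prod.ext rfl h.symm)

lemma ofTree_of_eq {q : GlueVertex} (h : q.1.1 = (0, 0)) : ofTree q.1.2 = q :=
  Subtype.ext (Prod.ext h.symm rfl)

/-- The edges of the tree. -/
def treePart : SimpleGraph GlueVertex where
  Adj q q' := polyTree.Adj q.1.2 q'.1.2 ∧ q.1.1 = (0, 0) ∧ q'.1.1 = (0, 0)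
  symm := ⟨fun _ _ h => ⟨h.1.symm, h.2.2, h.2.1⟩⟩
  loopless := ⟨fun _ h => polyTree.loopless.irrefl _ h.1⟩

/-- The edges of the square lattice. -/
def latticePart : SimpleGraph GlueVertex where
  Adj q q' := squareLattice.Adj q.1.1 q'.1.1 ∧ q.1.2 = treeRoot ∧ q'.1.2 = treeRoot
  symm := ⟨fun _ _ h => ⟨h.1.symm, h.2.2, h.2.1⟩⟩
  loopless := ⟨fun _ h => squareLattice.loopless.irrefl _ h.1⟩

lemma glueGraph_adj_ofLattice {u v : ℤ × ℤ} (h : squareLattice.Adj u v) :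
    glueGraph.Adj (ofLattice u) (ofLattice v) := Or.inl ⟨h, rfl, rfl⟩

lemma glueGraph_adj_ofTree {u v : TreeVertex} (h : polyTree.Adj u v) :
    glueGraph.Adj (ofTree u) (ofTree v) := Or.inr ⟨h, rfl, rfl⟩

lemma glueGraph_degree_le (q : GlueVertex) : (glueGraph.neighborSet q).encard ≤ 21 := by
  have h : glueGraph.neighborSet q ⊆ ofLattice '' squareLattice.neighborSet q.1.1 ∪
      ofTree '' polyTree.neighborSet q.1.2 := by
    rintro q' (⟨h1, -, h2⟩ | ⟨h1, -, h2⟩)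
    · exact Or.inl ⟨_, h1, ofLattice_of_eq h2⟩
    · exact Or.inr ⟨_, h1, ofTree_of_eq h2⟩
  calc _ ≤ _ := Set.encard_le_encard h
    _ ≤ _ := Set.encard_union_le _ _
    _ ≤ 4 + 17 := add_le_add
        ((Set.encard_image_le _ _).trans (squareLattice_degree_le _))
        ((Set.encard_image_le _ _).trans (polyTree_degree_le _))
    _ = 21 := by norm_num

lemma glueGraph_locFinite : LocFinite glueGraph :=
  fun x => Set.finite_of_encard_le_coe (k := 21) (glueGraph_degree_le x)

lemma glueGraph_connected : glueGraph.Connected := by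
  have h : ∀ q, glueGraph.Reachable gluePoint q := by
    intro q
    rcases q.2 with h | h
    · have := (polyTree_connected.preconnected treeRoot q.1.2).map
        (⟨ofTree, glueGraph_adj_ofTree⟩ : polyTree →g glueGraph)
      rw [← ofTree_of_eq h]
      exact this
    · have := (squareLattice_connected.preconnected (0, 0) q.1.1).map
        (⟨ofLattice, glueGraph_adj_ofLattice⟩ : squareLattice →g glueGraph)
      rw [← ofLattice_of_eq h]
      exact this
  exact { preconnected := fun x y => (h x).symm.trans (h y), nonempty := ⟨gluePoint⟩ }

lemma glueGraph_isTransient : IsTransient glueGraph :=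
  isTransient_of_capPos glueGraph_locFinite glueGraph_connected
    (polyTree_capPos.of_injective ofTree_injective fun _ _ => glueGraph_adj_ofTree)

/-! ### Percolation on the glued graph is supercritical for large `p` -/

lemma measure_lattice_cluster_finite_le (p : I) :
    percMeasure glueGraph p {ω | {u | ofLattice u ∈ cluster glueGraph ω gluePoint}.Finite} ≤
      ∑' n : ℕ, (4 * ENNReal.ofReal (1 - p)) ^ (n + 1) := by
  classical
  refine peierls (percMeasure glueGraph p) (fun e => {ω | e.map ofLattice ∉ ω}) (fun s hs => ?_)
    (fun ω => {u | ofLattice u ∈ cluster glueGraph ω gluePoint})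
    (fun ω => SimpleGraph.Reachable.refl _) fun ω u v hu hv huv hω => hv ?_
  · have h := setBernoulli_disjoint (u := glueGraph.edgeSet) p (A := s.image (Sym2.map ofLattice))
      (by
        intro e he
        obtain ⟨e', he', rfl⟩ := Finset.mem_image.1 (Finset.mem_coe.1 he)
        have := hs he'
        induction e' with
        | h a b => exact glueGraph_adj_ofLattice this)
    rw [Finset.card_image_of_injective _ (Sym2.map.injective ofLattice_injective)] at h
    simpa [percMeasure] using h.le
  · exact SimpleGraph.Reachable.trans hu
      (SimpleGraph.Adj.reachable ⟨glueGraph_adj_ofLattice huv, hω⟩)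

/-- The sum is `4 * q / (1 - 4 * q)`, and the denominator is at least `1 / 2`. -/
lemma tsum_geometric_le {q : ℝ} (h0 : 0 ≤ q) (h1 : q ≤ 1 / 8) :
    ∑' n : ℕ, (4 * ENNReal.ofReal q) ^ (n + 1) ≤ ENNReal.ofReal (8 * q) := by
  have h2 : (4 * ENNReal.ofReal q) = ENNReal.ofReal (4 * q) := by
    rw [ENNReal.ofReal_mul (by norm_num)]; norm_num
  have h3 : ∀ n : ℕ, ENNReal.ofReal (4 * q) ^ (n + 1) =
      ENNReal.ofReal ((4 * q) ^ n * (4 * q)) := fun n => by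
    rw [← pow_succ, ENNReal.ofReal_pow (by positivity)]
  simp only [h2, h3]
  have hs : Summable fun n : ℕ => (4 * q) ^ n * (4 * q) :=
    (summable_geometric_of_lt_one (by positivity) (by linarith)).mul_right _
  rw [← ENNReal.ofReal_tsum_of_nonneg (fun n => by positivity) hs]
  refine ENNReal.ofReal_le_ofReal ?_
  rw [tsum_mul_right, tsum_geometric_of_lt_one (by positivity) (by linarith), inv_mul_eq_div,
    div_le_iff₀ (by linarith)]
  nlinarith

lemma glueGraph_pc_lt_one (x : GlueVertex) : pc glueGraph x < 1 := by
  classical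
  obtain ⟨w⟩ := glueGraph_connected.preconnected x gluePoint
  set E := w.edges.toFinset with hE
  set k := E.card with hk
  -- A fixed walk from `x` to the gluing point has a closed edge with probability at most `k * q`,
  -- and the lattice part of the cluster is finite with probability at most `8 * q`. The sum `(k +
  -- 8) * q` must be below 1.
  set q : ℝ := 1 / (k + 9) with hq
  have hq0 : 0 < q := by positivity
  have hk0 : (0 : ℝ) ≤ k := Nat.cast_nonneg k
  have hq8 : q ≤ 1 / 8 := by
    rw [hq]; exact one_div_le_one_div_of_le (by norm_num) (by linarith)
  set p : I := ⟨1 - q, by linarith, by linarith⟩ with hp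
  have hpq : (1 : ℝ) - p = q := by simp [hp]
  have hp0 : (0 : I) < p := show (0 : ℝ) < 1 - q by linarith
  have hp1 : p < 1 := show (1 - q : ℝ) < 1 by linarith
  refine lt_of_le_of_lt (sInf_le ⟨⟨hp0, hp1⟩, ?_⟩) hp1
  set μ := percMeasure glueGraph p with hμ
  have : IsProbabilityMeasure μ := by rw [hμ, percMeasure]; infer_instance
  have h1 : μ {ω | ¬ (↑E ⊆ ω)} ≤ ENNReal.ofReal (k * q) := by
    calc _ ≤ μ (⋃ e ∈ E, {ω | e ∉ ω}) := by
          refine measure_mono fun ω hω => ?_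
          obtain ⟨e, he, hne⟩ := Set.not_subset.1 hω
          exact mem_biUnion he hne
      _ ≤ ∑ e ∈ E, μ {ω | e ∉ ω} := measure_biUnion_finset_le _ _
      _ ≤ ∑ e ∈ E, ENNReal.ofReal q := by
          refine Finset.sum_le_sum fun e he => ?_
          have h := setBernoulli_disjoint (u := glueGraph.edgeSet) p (A := {e}) (by
            simpa using w.edges_subset_edgeSet (List.mem_toFinset.1 he))
          rw [hpq] at h
          simpa [hμ, percMeasure] using h.le
      _ = _ := by
          rw [Finset.sum_const, nsmul_eq_mul, ENNReal.ofReal_mul (by positivity),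
            ENNReal.ofReal_natCast]
  have h2 := (measure_lattice_cluster_finite_le p).trans
    (tsum_geometric_le (by rw [hpq]; exact hq0.le) (by rw [hpq]; exact hq8))
  rw [hpq] at h2
  have hcover : (Set.univ : Set (Set (Sym2 GlueVertex))) ⊆
      {ω | (cluster glueGraph ω x).Infinite} ∪ ({ω | ¬ (↑E ⊆ ω)} ∪
        {ω | {u | ofLattice u ∈ cluster glueGraph ω gluePoint}.Finite}) := by
    intro ω _
    by_cases h3 : ↑E ⊆ ω
    · by_cases h4 : {u | ofLattice u ∈ cluster glueGraph ω gluePoint}.Finite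
      · exact Or.inr (Or.inr h4)
      · refine Or.inl fun hfin => h4 ?_
        have hr : (openGraph glueGraph ω).Reachable x gluePoint := by
          refine ⟨w.transfer _ fun e he => ?_⟩
          have h5 := w.edges_subset_edgeSet he
          have h6 : e ∈ ω := h3 (by simpa [hE] using he)
          induction e with
          | h a b => exact ⟨h5, h6⟩
        exact (hfin.preimage ofLattice_injective.injOn).subset fun u hu => hr.trans hu
    · exact Or.inr (Or.inl h3)
  by_contra h0
  rw [not_lt, nonpos_iff_eq_zero] at h0
  have h3 := (measure_mono hcover).trans ((measure_union_le _ _).trans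
    (add_le_add le_rfl (measure_union_le (μ := μ) _ _)))
  rw [measure_univ, h0, zero_add] at h3
  have h4 := h3.trans (add_le_add h1 h2)
  rw [← ENNReal.ofReal_add (by positivity) (by positivity), ← ENNReal.ofReal_one,
    ENNReal.ofReal_le_ofReal_iff (by positivity)] at h4
  have h5 : q * (k + 9) = 1 := by rw [hq]; field_simp
  nlinarith

/-! ### Enlargements of recurrent subgraphs of the glued graph -/

lemma treePart_isBridge {q q' : GlueVertex} (h : treePart.Adj q q') :
    glueGraph.IsBridge s(q, q') := by
  have key : ∀ {q q' : GlueVertex}, IsParent q.1.2 q'.1.2 → q.1.1 = (0, 0) → q'.1.1 = (0, 0) →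
      glueGraph.IsBridge s(q, q') := by
    intro q q' hp h1 h2
    refine isBridge_of_cut (D := {x : GlueVertex | x.1.2 ∈ descendants q'.1.2}) hp.notMem_descendants
      (self_mem_descendants _) fun x y hxy hx hy => ?_
    rcases hxy with ⟨-, h3, h4⟩ | ⟨h3, h4, h5⟩
    · simp only [Set.mem_ofPred_eq, h3, h4] at hx hy
      exact absurd hy hx
    · obtain ⟨h6, h7⟩ := enter_descendants h3 hx hy
      exact ⟨Subtype.ext (Prod.ext (h4.trans h1.symm) (h7.unique hp)),
        Subtype.ext (Prod.ext (h5.trans h2.symm) h6)⟩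
  rcases h with ⟨h | h, h1, h2⟩
  · exact key h h1 h2
  · rw [Sym2.eq_swap]; exact key h h2 h1

/-- The open edges of the tree that do not belong to `H`. -/
def bushes (ω : Set (Sym2 GlueVertex)) (H : glueGraph.Subgraph) : SimpleGraph GlueVertex where
  Adj q q' := treePart.Adj q q' ∧ s(q, q') ∈ ω ∧ ¬ H.Adj q q'
  symm := ⟨fun q q' h => ⟨h.1.symm, by rw [Sym2.eq_swap]; exact h.2.1, fun h' => h.2.2 h'.symm⟩⟩
  loopless := ⟨fun _ h => treePart.loopless.irrefl _ h.1⟩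

/-- Distinct vertices of a connected subgraph carry disjoint bushes. -/
lemma bushes_unique {ω : Set (Sym2 GlueVertex)} {H : glueGraph.Subgraph} (hH : H.coe.Connected)
    {y y' : GlueVertex} (hy : y ∈ H.verts) (hy' : y' ∈ H.verts)
    (h : (bushes ω H).Reachable y y') : y = y' := by
  obtain ⟨w, hw⟩ := h.exists_isPath
  cases w with
  | nil => rfl
  | cons ha w =>
    rename_i z
    exfalso
    rw [SimpleGraph.Walk.cons_isPath_iff] at hw
    -- The first edge of the bush path is a bridge, yet its ends stay connected without it: through
    -- `H`, which does not contain it, and along the rest of the path, which does not return to `y`.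
    have hb := treePart_isBridge ha.1
    rw [SimpleGraph.isBridge_iff] at hb
    refine hb (SimpleGraph.Reachable.trans (v := y') ?_ ?_)
    · have h1 := hH.preconnected ⟨y, hy⟩ ⟨y', hy'⟩
      refine h1.map (⟨Subtype.val, fun {a b} hab => ?_⟩ : H.coe →g glueGraph.deleteEdges {s(y, z)})
      rw [SimpleGraph.deleteEdges_adj]
      refine ⟨H.adj_sub hab, fun he => ha.2.2 ?_⟩
      have he' : s((a : GlueVertex), (b : GlueVertex)) = s(y, z) := he
      rw [← SimpleGraph.Subgraph.mem_edgeSet, ← he']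
      exact hab
    · refine SimpleGraph.Reachable.symm ⟨w.transfer _ fun e he => ?_⟩
      have h1 := w.edges_subset_edgeSet he
      rw [SimpleGraph.edgeSet_deleteEdges]
      refine ⟨?_, fun h2 => hw.2 ?_⟩
      · induction e with
        | h a b => exact Or.inr h1.1
      · rw [Set.mem_singleton_iff] at h2
        exact w.fst_mem_support_of_mem_edges (h2 ▸ he)


/-! ### Test functions on enlargements -/

open Classical in
/-- The extension of `h` from `Y` that is constant on each bush. -/
def bushExt (ω : Set (Sym2 GlueVertex)) (H : glueGraph.Subgraph) (Y : Set GlueVertex)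
    (h : GlueVertex → ℝ) (q : GlueVertex) : ℝ :=
  if hq : ∃ y ∈ Y, (bushes ω H).Reachable q y then h hq.choose else 0

lemma bushExt_of_reachable {ω : Set (Sym2 GlueVertex)} {H : glueGraph.Subgraph}
    {Y : Set GlueVertex} {h : GlueVertex → ℝ}
    (hY : ∀ y ∈ Y, ∀ y' ∈ Y, (bushes ω H).Reachable y y' → y = y') {q y : GlueVertex}
    (hy : y ∈ Y) (hq : (bushes ω H).Reachable q y) : bushExt ω H Y h q = h y := by
  have hex : ∃ y ∈ Y, (bushes ω H).Reachable q y := ⟨y, hy, hq⟩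
  rw [bushExt, dif_pos hex]
  rw [hY _ hex.choose_spec.1 _ hy (hex.choose_spec.2.symm.trans hq)]

lemma bushExt_eq_of_adj {ω : Set (Sym2 GlueVertex)} {H : glueGraph.Subgraph}
    {Y : Set GlueVertex} {h : GlueVertex → ℝ}
    (hY : ∀ y ∈ Y, ∀ y' ∈ Y, (bushes ω H).Reachable y y' → y = y') {q q' : GlueVertex}
    (hq : (bushes ω H).Adj q q') : bushExt ω H Y h q = bushExt ω H Y h q' := by
  by_cases hex : ∃ y ∈ Y, (bushes ω H).Reachable q y
  · obtain ⟨y, hy, hr⟩ := hex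
    rw [bushExt_of_reachable hY hy hr, bushExt_of_reachable hY hy (hq.symm.reachable.trans hr)]
  · have hex' : ¬ ∃ y ∈ Y, (bushes ω H).Reachable q' y :=
      fun ⟨y, hy, hr⟩ => hex ⟨y, hy, hq.reachable.trans hr⟩
    rw [bushExt, bushExt, dif_neg hex, dif_neg hex']

/-- The open edges of the tree. -/
def treeTrace (ω : Set (Sym2 GlueVertex)) : Set (Sym2 TreeVertex) := {e | e.map ofTree ∈ ω}

/-- A bush is either a single vertex or lies in the tree, inside an open tree cluster. -/
lemma bush_finite {ω : Set (Sym2 GlueVertex)} {H : glueGraph.Subgraph}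
    (hω : ∀ t, (cluster polyTree (treeTrace ω) t).Finite) (q : GlueVertex) :
    {q' | (bushes ω H).Reachable q q'}.Finite := by
  refine ((Set.finite_singleton q).union ((hω q.1.2).image ofTree)).subset fun q' hq' => ?_
  by_cases hne : q' = q
  · exact Or.inl hne
  · refine Or.inr ⟨q'.1.2, ?_, ofTree_of_eq ?_⟩
    · refine SimpleGraph.Reachable.map (⟨fun x => x.1.2, fun {a b} hab => ⟨hab.1.1, ?_⟩⟩ :
        bushes ω H →g openGraph polyTree (treeTrace ω)) hq'
      change s(ofTree a.1.2, ofTree b.1.2) ∈ ω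
      rw [ofTree_of_eq hab.1.2.1, ofTree_of_eq hab.1.2.2]
      exact hab.2.1
    · obtain ⟨w⟩ := hq'.symm
      cases w with
      | nil => exact absurd rfl hne
      | cons h _ => exact h.1.2.1

lemma bushExt_support_finite {ω : Set (Sym2 GlueVertex)} {H : glueGraph.Subgraph}
    (hω : ∀ t, (cluster polyTree (treeTrace ω) t).Finite) (Y : Set GlueVertex)
    {h : GlueVertex → ℝ} (hh : h.support.Finite) : (bushExt ω H Y h).support.Finite := by
  refine (hh.biUnion fun y _ => bush_finite (H := H) hω y).subset fun q hq => ?_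
  by_cases hex : ∃ y ∈ Y, (bushes ω H).Reachable q y
  · have h1 : bushExt ω H Y h q = h hex.choose := dif_pos hex
    exact mem_biUnion (x := hex.choose) (show h _ ≠ 0 from h1 ▸ hq) hex.choose_spec.2.symm
  · exact absurd (dif_neg hex) hq

open Classical in
/-- The function equal to `z` on the square lattice and to `e` on the tree. -/
def glueFun (z : ℤ × ℤ → ℝ) (e : GlueVertex → ℝ) (q : GlueVertex) : ℝ :=
  if q.1.2 = treeRoot then z q.1.1 else e q

lemma glueFun_of_root {z : ℤ × ℤ → ℝ} {e : GlueVertex → ℝ} {q : GlueVertex}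
    (h : q.1.2 = treeRoot) : glueFun z e q = z q.1.1 := if_pos h

lemma glueFun_of_origin {z : ℤ × ℤ → ℝ} {e : GlueVertex → ℝ} (h0 : e gluePoint = z (0, 0))
    {q : GlueVertex} (h : q.1.1 = (0, 0)) : glueFun z e q = e q := by
  by_cases hq : q.1.2 = treeRoot
  · rw [glueFun_of_root hq, h, ← h0]
    congr 1
    exact Subtype.ext (Prod.ext h.symm hq.symm)
  · exact if_neg hq

lemma glueFun_support_finite {z : ℤ × ℤ → ℝ} {e : GlueVertex → ℝ} (hz : z.support.Finite)
    (he : e.support.Finite) : (glueFun z e).support.Finite := by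
  refine ((hz.image ofLattice).union he).subset fun q hq => ?_
  by_cases h : q.1.2 = treeRoot
  · refine Or.inl ⟨q.1.1, ?_, ofLattice_of_eq h⟩
    rw [Function.mem_support, glueFun_of_root h] at hq
    exact hq
  · refine Or.inr ?_
    rw [Function.mem_support, glueFun, if_neg h] at hq
    exact hq

/-- An edge of the enlargement is of one of three kinds: a lattice edge, charged to `z`; a tree edge
of `H`, charged to `h`; or another open tree edge, which lies in a bush and costs nothing. -/
lemma energy_glueFun_le {ω : Set (Sym2 GlueVertex)} {H : glueGraph.Subgraph}
    {Y : Set GlueVertex} {h : GlueVertex → ℝ}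
    (hY : ∀ y ∈ Y, ∀ y' ∈ Y, (bushes ω H).Reachable y y' → y = y')
    (hH : ∀ q q', H.Adj q q' → treePart.Adj q q' → q ∈ Y ∧ q' ∈ Y) {z : ℤ × ℤ → ℝ}
    (h0 : bushExt ω H Y h gluePoint = z (0, 0)) :
    energy (enlarge ω H).spanningCoe (glueFun z (bushExt ω H Y h)) ≤
      energy H.spanningCoe h + energy squareLattice z := by
  classical
  have h1 : energy latticePart (fun q => z q.1.1) ≤ energy squareLattice z :=
    le_energy_comp (G := latticePart) (φ := ofLattice) ofLattice_injective (fun u v huv =>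
      ⟨u.1.1, v.1.1, huv.1, ofLattice_of_eq huv.2.1, ofLattice_of_eq huv.2.2⟩) _
  refine le_trans ?_ (add_le_add le_rfl h1)
  rw [energy, energy, energy, ← ENNReal.tsum_add]
  refine ENNReal.tsum_le_tsum fun ⟨q, q'⟩ => ?_
  simp only [SimpleGraph.Subgraph.spanningCoe_adj]
  by_cases hU : (enlarge ω H).Adj q q'
  swap
  · rw [if_neg hU]; exact zero_le
  rw [if_pos hU]
  rcases (enlarge ω H).adj_sub hU with hl | ht
  · refine le_trans ?_ le_add_self
    rw [if_pos (show latticePart.Adj q q' from hl), glueFun_of_root hl.2.1,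
      glueFun_of_root hl.2.2]
  · rw [glueFun_of_origin h0 ht.2.1, glueFun_of_origin h0 ht.2.2]
    by_cases hHq : H.Adj q q'
    · refine le_trans ?_ le_self_add
      obtain ⟨h2, h3⟩ := hH q q' hHq ht
      rw [if_pos hHq, bushExt_of_reachable hY h2 (SimpleGraph.Reachable.refl _),
        bushExt_of_reachable hY h3 (SimpleGraph.Reachable.refl _)]
    · have h4 : (bushes ω H).Adj q q' := by
        refine ⟨ht, ?_, hHq⟩
        rcases hU with h5 | ⟨_, _, _, _, h5⟩
        · exact absurd h5 hHq
        · exact h5.2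
      rw [bushExt_eq_of_adj hY h4]
      simp

lemma glueFun_restrict {ω : Set (Sym2 GlueVertex)} {H : glueGraph.Subgraph}
    {f : GlueVertex → ℝ} (hf : f.support.Finite) {x : GlueVertex} (hx : x ∈ (enlarge ω H).verts)
    (h1 : f x = 1) {ε : NNReal} (hE : energy (enlarge ω H).spanningCoe f ≤ ε) :
    ∃ g : (enlarge ω H).verts → ℝ, g.support.Finite ∧ g ⟨x, hx⟩ = 1 ∧
      energy (enlarge ω H).coe g ≤ ε :=
  ⟨f ∘ Subtype.val, hf.preimage Subtype.val_injective.injOn, h1,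
    (energy_comp_le Subtype.val_injective (fun _ _ h => h) f).trans hE⟩

lemma subset_enlarge {G : SimpleGraph V} (ω : Set (Sym2 V)) (H : G.Subgraph) {x : V}
    (hx : x ∈ H.verts) : x ∈ (enlarge ω H).verts :=
  mem_biUnion hx (SimpleGraph.Reachable.refl x)

lemma not_isTransient_enlarge {ω : Set (Sym2 GlueVertex)} {H : glueGraph.Subgraph}
    (hH : IsRecurrent H.coe) (hω : ∀ t, (cluster polyTree (treeTrace ω) t).Finite) :
    ¬ IsTransient (enlarge ω H).coe := by
  classical
  have hcap : ∀ x, ¬ CapPos H.coe x := fun x hx => by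
    have h1 := (green_lt_top_iff (glueGraph_locFinite.coe H) hH.1 x).2 hx
    rw [hH.2 x] at h1
    exact lt_irrefl _ h1
  suffices h : ∃ x, ∃ hx : x ∈ (enlarge ω H).verts, ¬ CapPos (enlarge ω H).coe ⟨x, hx⟩ by
    obtain ⟨x, hx, hn⟩ := h
    exact fun ht => hn ((green_lt_top_iff (glueGraph_locFinite.coe _) ht.1 _).1 (ht.2 _))
  -- If `H` meets the tree, root included, its own test function governs the tree side. Otherwise a
  -- lattice test function suffices, extended by its value at the origin over the bush of the gluing
  -- point.
  by_cases hT : ∃ x ∈ H.verts, x.1.1 = (0, 0)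
  · obtain ⟨x, hx, hx0⟩ := hT
    refine ⟨x, subset_enlarge ω H hx, not_capPos_of_forall_exists fun ε hε => ?_⟩
    obtain ⟨g, hg, hg1, hgE⟩ :=
      exists_energy_le_of_not_capPos (hcap ⟨x, hx⟩) (half_pos hε)
    set h : GlueVertex → ℝ := fun q => if hq : q ∈ H.verts then g ⟨q, hq⟩ else 0 with hh
    have hcomp : h ∘ Subtype.val = g := by
      ext q
      simp [hh]
    have hhf : h.support.Finite := by
      refine (hg.image Subtype.val).subset fun q hq => ?_
      by_cases hq' : q ∈ H.verts
      · exact ⟨⟨q, hq'⟩, by simpa [hh, hq'] using hq, rfl⟩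
      · exact absurd (dif_neg hq') hq
    have hhE : energy H.spanningCoe h ≤ (ε / 2 : NNReal) := by
      refine (le_energy_comp (X := H.coe) (φ := Subtype.val) Subtype.val_injective
        (fun u v huv => ⟨⟨u, H.edge_vert huv⟩, ⟨v, H.edge_vert huv.symm⟩, huv, rfl, rfl⟩)
        h).trans ?_
      rw [hcomp]
      exact hgE
    have hY : ∀ y ∈ H.verts, ∀ y' ∈ H.verts, (bushes ω H).Reachable y y' → y = y' :=
      fun y hy y' hy' => bushes_unique hH.1 hy hy'
    set a := bushExt ω H H.verts h gluePoint with ha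
    -- Multiplication by `a`, the value to be matched at the gluing point, scales the energy by `a ^
    -- 2`; the divisor `a ^ 2 + 1` absorbs this and stays positive when `a = 0`.
    obtain ⟨ζ, hζ, hζ1, hζE⟩ := exists_energy_le_of_not_capPos (squareLattice_not_capPos (0, 0))
      (ε := ε / 2 / Real.toNNReal (a ^ 2 + 1))
      (div_pos (half_pos hε) (Real.toNNReal_pos.2 (by positivity)))
    have hzE : energy squareLattice (fun u => a * ζ u) ≤ (ε / 2 : NNReal) := by
      rw [energy_const_mul]
      refine (mul_le_mul_right hζE _).trans ?_
      rw [ENNReal.ofReal, ← ENNReal.coe_mul, ENNReal.coe_le_coe, mul_div_assoc']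
      refine div_le_of_le_mul₀ zero_le zero_le ?_
      rw [mul_comm]
      exact mul_le_mul_right (Real.toNNReal_le_toNNReal (by linarith)) _
    refine glueFun_restrict (f := glueFun (fun u => a * ζ u) (bushExt ω H H.verts h))
      (glueFun_support_finite (hζ.subset fun u hu => right_ne_zero_of_mul hu)
        (bushExt_support_finite hω _ hhf)) _ ?_ ?_
    · rw [glueFun_of_origin (by rw [hζ1, mul_one]) hx0,
        bushExt_of_reachable hY hx (SimpleGraph.Reachable.refl _), hh]
      simp [hx, hg1]
    · refine (energy_glueFun_le hY (fun q q' hq _ => ⟨H.edge_vert hq, H.edge_vert hq.symm⟩)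
        (by rw [hζ1, mul_one])).trans ((add_le_add hhE hzE).trans ?_)
      rw [← ENNReal.coe_add, add_halves]
  · push Not at hT
    obtain ⟨⟨x, hx⟩⟩ := hH.1.nonempty
    have hroot : x.1.2 = treeRoot := x.2.resolve_left (hT x hx)
    refine ⟨x, subset_enlarge ω H hx, not_capPos_of_forall_exists fun ε hε => ?_⟩
    obtain ⟨ζ, hζ, hζ1, hζE⟩ := exists_energy_le_of_not_capPos (squareLattice_not_capPos x.1.1) hε
    set h : GlueVertex → ℝ := fun q => if q = gluePoint then ζ (0, 0) else 0 with hh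
    have hhf : h.support.Finite := (Set.finite_singleton gluePoint).subset fun q hq => by
      by_contra hne
      exact hq (if_neg hne)
    have hhE : energy H.spanningCoe h = 0 := by
      refine ENNReal.tsum_eq_zero.2 fun e => ?_
      split_ifs with he
      · have h1 : ∀ q ∈ H.verts, h q = 0 := fun q hq =>
          if_neg fun h2 => hT q hq (by rw [h2]; rfl)
        rw [h1 _ (H.edge_vert he), h1 _ (H.edge_vert he.symm)]
        simp
      · rfl
    have hY : ∀ y ∈ ({gluePoint} : Set GlueVertex), ∀ y' ∈ ({gluePoint} : Set GlueVertex),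
        (bushes ω H).Reachable y y' → y = y' := by
      rintro y rfl y' rfl _
      rfl
    have h0 : bushExt ω H {gluePoint} h gluePoint = ζ (0, 0) := by
      rw [bushExt_of_reachable hY rfl (SimpleGraph.Reachable.refl _)]
      simp [hh]
    refine glueFun_restrict (f := glueFun ζ (bushExt ω H {gluePoint} h))
      (glueFun_support_finite hζ (bushExt_support_finite hω _ hhf)) _ ?_ ?_
    · rw [glueFun_of_root hroot, hζ1]
    · refine (energy_glueFun_le hY (fun q q' hq ht => absurd ht.2.1 (hT q (H.edge_vert hq)))
        h0).trans ?_
      rw [hhE, zero_add]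
      exact hζE

lemma glueGraph_pc1 {H : glueGraph.Subgraph} (hH : IsRecurrent H.coe) :
    pc1 glueGraph H (transientSubgraphs glueGraph) = 1 := by
  classical
  refine sInf_eq_top.2 fun p hp => ?_
  by_contra hne
  have hp1 : (p : ℝ) < 1 := lt_of_le_of_ne p.2.2 fun h => hne (Subtype.ext h)
  have hae : ∀ᵐ ω ∂percMeasure glueGraph p, ∀ t,
      (cluster polyTree (treeTrace ω) t).Finite := by
    rw [ae_all_iff]
    intro t
    have := polyTree_measure_cluster_infinite (percMeasure glueGraph p) treeTrace p.2.1 hp1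
      (fun s hs => ?_) t
    · rw [ae_iff]
      exact this
    · have h1 := setBernoulli_subset (u := glueGraph.edgeSet) p
        (A := s.image (Sym2.map ofTree)) (by
          intro e he
          obtain ⟨e', he', rfl⟩ := Finset.mem_image.1 (Finset.mem_coe.1 he)
          have := hs he'
          induction e' with
          | h a b => exact glueGraph_adj_ofTree this)
      rw [Finset.card_image_of_injective _ (Sym2.map.injective ofTree_injective)] at h1
      rw [← h1]
      refine measure_mono fun ω hω => ?_
      simp only [Set.mem_ofPred_eq, Finset.coe_image, Set.image_subset_iff]
      exact hω
  have hnull : percMeasure glueGraph p {ω | enlarge ω H ∈ transientSubgraphs glueGraph} = 0 := by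
    have h1 := ae_iff.1 hae
    refine measure_mono_null (fun ω hω => ?_) h1
    exact fun h => not_isTransient_enlarge hH h hω
  exact absurd hnull (ne_of_gt hp)

/-! ### The half-line with multiple edges -/

/-- A half-line in which `2 ^ k` disjoint paths of length two join the `k`-th vertex to the next
one is transient. -/
lemma capPos_of_multiple_line {X : SimpleGraph V} {a : ℕ → V} {b : ∀ k, Fin (2 ^ k) → V}
    (ha : Function.Injective a) (hb : ∀ k, Function.Injective (b k))
    (h1 : ∀ k i, X.Adj (a k) (b k i)) (h2 : ∀ k i, X.Adj (b k i) (a (k + 1))) :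
    CapPos X (a 0) := by
  refine ⟨64, fun f hf => ?_⟩
  by_cases hE : energy X f = ∞
  · rw [hE]; simp
  set E := (energy X f).toReal with hEdef
  have hE0 : 0 ≤ E := ENNReal.toReal_nonneg
  have hstep : ∀ k, |f (a k) - f (a (k + 1))| ≤ √E * (2 * (3 / 4) ^ k) := by
    intro k
    have h3 : ∑ i, (f (a k) - f (b k i)) ^ 2 ≤ E := by
      rw [← ENNReal.ofReal_le_iff_le_toReal hE]
      exact sum_sq_le_energy (fun i _ j _ hij => hb k (congrArg Prod.snd hij))
        (fun i _ => h1 k i) f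
    have h4 : ∑ i, (f (b k i) - f (a (k + 1))) ^ 2 ≤ E := by
      rw [← ENNReal.ofReal_le_iff_le_toReal hE]
      exact sum_sq_le_energy (fun i _ j _ hij => hb k (congrArg Prod.fst hij))
        (fun i _ => h2 k i) f
    have h5 : (2 : ℝ) ^ k * (f (a k) - f (a (k + 1))) ^ 2 ≤ 4 * E := by
      calc (2 : ℝ) ^ k * (f (a k) - f (a (k + 1))) ^ 2
          = ∑ _i : Fin (2 ^ k), (f (a k) - f (a (k + 1))) ^ 2 := by simp
        _ ≤ ∑ i, (2 * (f (a k) - f (b k i)) ^ 2 + 2 * (f (b k i) - f (a (k + 1))) ^ 2) :=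
            Finset.sum_le_sum fun i _ => by
              nlinarith [sq_nonneg ((f (a k) - f (b k i)) - (f (b k i) - f (a (k + 1))))]
        _ ≤ 4 * E := by
            rw [Finset.sum_add_distrib, ← Finset.mul_sum, ← Finset.mul_sum]
            linarith
    -- The ratio `3 / 4` is a rational substitute for `1 / √2`, valid since `2 * (3 / 4) ^ 2 ≥ 1`.
    -- The increments then sum to at most `8 * √E`, hence the constant 64.
    rw [← Real.sqrt_sq (show (0 : ℝ) ≤ 2 * (3 / 4) ^ k by positivity), ← Real.sqrt_mul hE0]
    refine Real.abs_le_sqrt ?_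
    have h6 : (1 : ℝ) ≤ 2 ^ k * ((3 / 4) ^ k) ^ 2 := by
      rw [← pow_mul, mul_comm k, pow_mul, ← mul_pow]
      exact one_le_pow₀ (by norm_num)
    have h7 : 0 ≤ (f (a k) - f (a (k + 1))) ^ 2 := sq_nonneg _
    calc (f (a k) - f (a (k + 1))) ^ 2
        ≤ (2 ^ k * ((3 / 4) ^ k) ^ 2) * (f (a k) - f (a (k + 1))) ^ 2 := le_mul_of_one_le_left h7 h6
      _ = ((3 / 4) ^ k) ^ 2 * (2 ^ k * (f (a k) - f (a (k + 1))) ^ 2) := by ring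
      _ ≤ ((3 / 4) ^ k) ^ 2 * (4 * E) := by gcongr
      _ = _ := by ring
  have hsum : ∀ N, |f (a 0) - f (a N)| ≤ √E * (8 * (1 - (3 / 4) ^ N)) := by
    intro N
    induction N with
    | zero => simp
    | succ N ih =>
      calc |f (a 0) - f (a (N + 1))|
          ≤ |f (a 0) - f (a N)| + |f (a N) - f (a (N + 1))| := abs_sub_le _ _ _
        _ ≤ √E * (8 * (1 - (3 / 4) ^ N)) + √E * (2 * (3 / 4) ^ N) := add_le_add ih (hstep N)
        _ = _ := by rw [pow_succ]; ring
  obtain ⟨N, hN⟩ : ∃ N, f (a N) = 0 := by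
    by_contra hcon
    push Not at hcon
    exact (Set.infinite_range_of_injective ha) (hf.subset (by rintro _ ⟨n, rfl⟩; exact hcon n))
  have h3 := hsum N
  rw [hN, sub_zero] at h3
  have h4 : |f (a 0)| ≤ √E * 8 := by
    refine h3.trans (mul_le_mul_of_nonneg_left ?_ (Real.sqrt_nonneg _))
    have : (0 : ℝ) ≤ (3 / 4) ^ N := by positivity
    linarith
  have h5 : f (a 0) ^ 2 ≤ 64 * E := by
    rw [← sq_abs]
    calc |f (a 0)| ^ 2 ≤ (√E * 8) ^ 2 := by gcongr
      _ = 64 * (√E) ^ 2 := by ring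
      _ = _ := by rw [Real.sq_sqrt hE0]
  rw [← ENNReal.ofReal_toReal hE, ← ENNReal.ofReal_coe_nnreal, ← ENNReal.ofReal_mul (by simp)]
  exact ENNReal.ofReal_le_ofReal (by simpa using h5)

/-- The multiplicities of the edges of the half-line. -/
abbrev lineMult (k : ℕ) : ℕ := 2 ^ k * 2 ^ k

/-- The vertices of the subdivided half-line. -/
abbrev LineVertex : Type := ℕ ⊕ (Σ k : ℕ, Fin (lineMult k))

/-- The subdivided half-line with multiplicities `lineMult`. -/
abbrev lineGraph : SimpleGraph LineVertex := multiLine lineMult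

/-- The middle of an edge of the half-line. -/
def lineMid (k : ℕ) (i : Fin (lineMult k)) : LineVertex := Sum.inr ⟨k, i⟩

lemma lineMid_injective (k : ℕ) : Function.Injective (lineMid k) := by
  intro i j h
  simpa [lineMid] using h

lemma lineGraph_adj_left (k : ℕ) (i : Fin (lineMult k)) :
    lineGraph.Adj (Sum.inl k) (lineMid k i) :=
  (SimpleGraph.fromRel_adj _ _ _).2 ⟨Sum.inl_ne_inr, Or.inl ⟨k, i, Or.inl rfl, rfl⟩⟩

lemma lineGraph_adj_right (k : ℕ) (i : Fin (lineMult k)) :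
    lineGraph.Adj (lineMid k i) (Sum.inl (k + 1)) :=
  (SimpleGraph.fromRel_adj _ _ _).2 ⟨Sum.inr_ne_inl, Or.inr ⟨k, i, Or.inr rfl, rfl⟩⟩

/-- The position of a vertex on the subdivided half-line. -/
def linePos : LineVertex → ℕ
  | Sum.inl k => 2 * k
  | Sum.inr ⟨k, _⟩ => 2 * k + 1

lemma linePos_le_of_adj {u v : LineVertex} (h : lineGraph.Adj u v) :
    linePos v ≤ linePos u + 1 := by
  rcases ((SimpleGraph.fromRel_adj _ _ _).1 h).2 with
    ⟨k, i, rfl | rfl, rfl⟩ | ⟨k, i, rfl | rfl, rfl⟩ <;>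
    simp only [linePos] <;> omega

lemma finite_linePos_le (n : ℕ) : {v | linePos v ≤ n}.Finite := by
  refine (((Set.finite_Iic n).image Sum.inl).union ((Set.finite_Iic n).biUnion fun k _ =>
    Set.finite_range (lineMid k))).subset ?_
  rintro (k | ⟨k, i⟩) h
  · refine Or.inl ⟨k, ?_, rfl⟩
    simp only [linePos, Set.mem_ofPred_eq] at h
    rw [mem_Iic]; omega
  · refine Or.inr (mem_biUnion (x := k) ?_ ⟨i, rfl⟩)
    simp only [linePos, Set.mem_ofPred_eq] at h
    rw [mem_Iic]; omega

lemma lineGraph_locFinite : LocFinite lineGraph := fun v =>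
  (finite_linePos_le (linePos v + 1)).subset fun _ hw => linePos_le_of_adj hw

lemma lineGraph_connected : lineGraph.Connected := by
  have h1 : ∀ k : ℕ, lineGraph.Reachable (Sum.inl 0) (Sum.inl k) := by
    intro k
    induction k with
    | zero => exact SimpleGraph.Reachable.refl _
    | succ k ih =>
      have i : Fin (lineMult k) := ⟨0, by positivity⟩
      exact ih.trans ((lineGraph_adj_left k i).reachable.trans (lineGraph_adj_right k i).reachable)
  have h2 : ∀ v, lineGraph.Reachable (Sum.inl 0) v := by
    rintro (k | ⟨k, i⟩)
    · exact h1 k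
    · exact (h1 k).trans (lineGraph_adj_left k i).reachable
  exact { preconnected := fun x y => (h2 x).symm.trans (h2 y), nonempty := ⟨Sum.inl 0⟩ }

/-- The `j`-th edge of the `g`-th of `2 ^ k` groups of edges between `k` and `k + 1`. -/
def groupIndex {k : ℕ} (g j : Fin (2 ^ k)) : Fin (lineMult k) := finProdFinEquiv (g, j)

lemma groupIndex_inj {k : ℕ} {g j g' j' : Fin (2 ^ k)} (h : groupIndex g j = groupIndex g' j') :
    g = g' ∧ j = j' := by
  have := finProdFinEquiv.injective h
  exact Prod.mk.inj this

lemma lineGraph_isTransient : IsTransient lineGraph := by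
  refine isTransient_of_capPos lineGraph_locFinite lineGraph_connected
    (capPos_of_multiple_line (a := Sum.inl) (b := fun k g => lineMid k (groupIndex g g))
      Sum.inl_injective (fun k g g' h => ?_) (fun k i => lineGraph_adj_left k _)
      fun k i => lineGraph_adj_right k _)
  exact (groupIndex_inj (lineMid_injective k h)).1

/-- An infinite connected subgraph of the half-line contains all but finitely many of the original
vertices. -/
lemma eventually_mem_verts {H : lineGraph.Subgraph} (hinf : H.verts.Infinite)
    (hH : H.coe.Connected) : ∃ k₀, ∀ k ≥ k₀, (Sum.inl k : LineVertex) ∈ H.verts := by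
  obtain ⟨⟨x, hx⟩⟩ := hH.nonempty
  refine ⟨linePos x + 1, fun k hk => ?_⟩
  obtain ⟨v, hv, hvk⟩ : ∃ v ∈ H.verts, 2 * k < linePos v := by
    by_contra hcon
    push Not at hcon
    exact hinf ((finite_linePos_le (2 * k)).subset hcon)
  -- Positions increase by at most 1 along an edge, so `H` has a vertex at position exactly `2 * k`.
  -- Midpoints have odd positions, so this is the original vertex `k`.
  obtain ⟨a, b, hab, ha, hb⟩ := exists_crossing (D := {u : H.verts | 2 * k < linePos u.1})
    (hH.preconnected ⟨x, hx⟩ ⟨v, hv⟩) (by simp only [Set.mem_ofPred_eq]; omega) hvk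
  have h1 := linePos_le_of_adj (H.adj_sub hab)
  simp only [Set.mem_ofPred_eq] at ha hb
  have h2 : linePos a.1 = 2 * k := by omega
  obtain ⟨a, hav⟩ := a
  rcases a with k' | ⟨k', i⟩
  · simp only [linePos] at h2
    obtain rfl : k' = k := by omega
    exact hav
  · simp only [linePos] at h2
    omega

/-! ### Connectedness of enlargements -/

lemma mem_enlarge_of_mem_cluster {G : SimpleGraph V} {ω : Set (Sym2 V)} {H : G.Subgraph} {x y : V}
    (hx : x ∈ H.verts) (hy : y ∈ cluster G ω x) : y ∈ (enlarge ω H).verts :=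
  mem_biUnion hx hy

lemma enlarge_connected {G : SimpleGraph V} (ω : Set (Sym2 V)) {H : G.Subgraph}
    (hH : H.coe.Connected) : (enlarge ω H).coe.Connected := by
  have h1 : ∀ x (hx : x ∈ H.verts) y (hy : y ∈ H.verts), (enlarge ω H).coe.Reachable
      ⟨x, subset_enlarge ω H hx⟩ ⟨y, subset_enlarge ω H hy⟩ := fun x hx y hy =>
    (hH.preconnected ⟨x, hx⟩ ⟨y, hy⟩).map (⟨fun z => ⟨z.1, subset_enlarge ω H z.2⟩,
      fun {a b} hab => Or.inl hab⟩ : H.coe →g (enlarge ω H).coe)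
  have h2 : ∀ x (hx : x ∈ H.verts), ∀ u v (_ : (openGraph G ω).Walk u v) (hu : u ∈ cluster G ω x)
      (hv : v ∈ cluster G ω x), (enlarge ω H).coe.Reachable
        ⟨u, mem_enlarge_of_mem_cluster hx hu⟩ ⟨v, mem_enlarge_of_mem_cluster hx hv⟩ := by
    intro x hx u v w
    induction w with
    | nil => exact fun _ _ => SimpleGraph.Reachable.refl _
    | cons h w ih =>
      rename_i z _
      intro hu hv
      have hz : z ∈ cluster G ω x := SimpleGraph.Reachable.trans hu h.reachable
      exact SimpleGraph.Reachable.trans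
        (SimpleGraph.Adj.reachable (Or.inr ⟨x, hx, hu, hz, h⟩)) (ih hz hv)
  obtain ⟨⟨o, ho⟩⟩ := hH.nonempty
  have h3 : ∀ v, (enlarge ω H).coe.Reachable ⟨o, subset_enlarge ω H ho⟩ v := by
    rintro ⟨v, hv⟩
    obtain ⟨x, hx, hv'⟩ := mem_iUnion₂.1 hv
    have hv'' : v ∈ cluster G ω x := hv'
    obtain ⟨w⟩ := hv'
    exact (h1 o ho x hx).trans (h2 x hx x v w (SimpleGraph.Reachable.refl _) hv'')
  exact { preconnected := fun x y => (h3 x).symm.trans (h3 y),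
          nonempty := ⟨⟨o, subset_enlarge ω H ho⟩⟩ }

/-! ### Enlargements in the half-line -/

/-- The two halves of an edge of the half-line. -/
def halves (k : ℕ) (i : Fin (lineMult k)) : Finset (Sym2 LineVertex) := by
  classical
  exact {s(Sum.inl k, lineMid k i), s(lineMid k i, Sum.inl (k + 1))}

lemma mem_halves {k : ℕ} {i : Fin (lineMult k)} {e : Sym2 LineVertex} :
    e ∈ halves k i ↔ e = s(Sum.inl k, lineMid k i) ∨ e = s(lineMid k i, Sum.inl (k + 1)) := by
  classical
  simp [halves]

lemma halves_card (k : ℕ) (i : Fin (lineMult k)) : (halves k i).card = 2 := by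
  classical
  rw [halves, Finset.card_pair]
  simp [lineMid]

lemma halves_subset (k : ℕ) (i : Fin (lineMult k)) : ↑(halves k i) ⊆ lineGraph.edgeSet := by
  intro e he
  rcases mem_halves.1 (Finset.mem_coe.1 he) with rfl | rfl
  · exact lineGraph_adj_left k i
  · exact lineGraph_adj_right k i

lemma halves_disjoint {k : ℕ} {i j : Fin (lineMult k)} (h : i ≠ j) :
    Disjoint (halves k i) (halves k j) := by
  refine Finset.disjoint_left.2 fun e he he' => h ?_
  have h1 : lineMid k i ∈ e := by
    rcases mem_halves.1 he with rfl | rfl <;> simp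
  have h2 : ∀ e' ∈ halves k j, lineMid k i ∈ e' → i = j := by
    intro e' he' hm
    rcases mem_halves.1 he' with rfl | rfl <;> simpa [lineMid] using hm
  exact h2 e he' h1

/-- Some group of edges between `k` and `k + 1` contains no fully open edge. -/
def badEvent (k : ℕ) : Set (Set (Sym2 LineVertex)) :=
  {ω | ∃ g : Fin (2 ^ k), ∀ j, ¬ ↑(halves k (groupIndex g j)) ⊆ ω}

/-- Union bound over the groups, with independence inside each. The bound is written as `n ^ 1 * r ^
n` at `n = 2 ^ k`, so that its summability is that of a subfamily of `n * r ^ n`. -/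
lemma measure_badEvent_le (p : I) (k : ℕ) : percMeasure lineGraph p (badEvent k) ≤
    ENNReal.ofReal (((2 ^ k : ℕ) : ℝ) ^ 1 * (1 - (p : ℝ) ^ 2) ^ (2 ^ k)) := by
  classical
  have hp : (0 : ℝ) ≤ 1 - (p : ℝ) ^ 2 := by nlinarith [p.2.1, p.2.2]
  have h1 : ∀ g : Fin (2 ^ k), percMeasure lineGraph p
      {ω | ∀ j, ¬ ↑(halves k (groupIndex g j)) ⊆ ω} =
        ENNReal.ofReal ((1 - (p : ℝ) ^ 2) ^ (2 ^ k)) := by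
    intro g
    have h := setBernoulli_real_blocks (u := lineGraph.edgeSet) p
      (B := fun j : Fin (2 ^ k) => halves k (groupIndex g j)) Finset.univ (A := ∅) (by simp)
      (fun j _ => halves_subset k _)
      (fun j _ j' _ hj => halves_disjoint fun h => hj (groupIndex_inj h).2) (by simp)
    simp only [Finset.coe_empty, Set.empty_subset, true_and, Finset.mem_univ, forall_const,
      Finset.card_empty, pow_zero, one_mul, halves_card, Finset.prod_const, Finset.card_univ,
      Fintype.card_fin] at h
    rw [← h, ofReal_measureReal]
    rfl
  calc _ ≤ percMeasure lineGraph p (⋃ g : Fin (2 ^ k),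
        {ω | ∀ j, ¬ ↑(halves k (groupIndex g j)) ⊆ ω}) :=
        measure_mono fun ω hω => by
          obtain ⟨g, hg⟩ := hω
          exact mem_iUnion.2 ⟨g, hg⟩
    _ ≤ ∑ g : Fin (2 ^ k), percMeasure lineGraph p
        {ω | ∀ j, ¬ ↑(halves k (groupIndex g j)) ⊆ ω} := measure_iUnion_fintype_le _ _
    _ = _ := by
        rw [Finset.sum_congr rfl fun g _ => h1 g, Finset.sum_const, Finset.card_univ,
          Fintype.card_fin, nsmul_eq_mul, pow_one, ENNReal.ofReal_mul (by positivity),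
          ENNReal.ofReal_natCast]

lemma ae_eventually_notMem_badEvent {p : I} (hp : 0 < p) :
    ∀ᵐ ω ∂percMeasure lineGraph p, ∀ᶠ k in Filter.atTop, ω ∉ badEvent k := by
  refine ae_eventually_notMem (ne_top_of_le_ne_top ?_
    (ENNReal.tsum_le_tsum fun k => measure_badEvent_le p k))
  have hp0 : (0 : ℝ) < p := hp
  have hnorm : ‖1 - (p : ℝ) ^ 2‖ < 1 := by
    rw [Real.norm_eq_abs, abs_lt]
    constructor <;> nlinarith [p.2.2]
  have h1 := (summable_pow_mul_geometric_of_norm_lt_one 1 hnorm).comp_injective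
    (Nat.pow_right_injective (le_refl 2))
  exact h1.tsum_ofReal_ne_top

lemma enlarge_mem_transientSubgraphs {H : lineGraph.Subgraph} (hinf : H.verts.Infinite)
    (hH : H.coe.Connected) {ω : Set (Sym2 LineVertex)}
    (hω : ∀ᶠ k in Filter.atTop, ω ∉ badEvent k) :
    enlarge ω H ∈ transientSubgraphs lineGraph := by
  obtain ⟨k₀, hk₀⟩ := eventually_mem_verts hinf hH
  obtain ⟨k₁, hk₁⟩ := Filter.eventually_atTop.1 hω
  set K := max k₀ k₁ with hK
  have hmem : ∀ k, (Sum.inl (K + k) : LineVertex) ∈ H.verts := fun k => hk₀ _ (by omega)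
  have hopen : ∀ k (g : Fin (2 ^ (K + k))), ∃ j, ↑(halves (K + k) (groupIndex g j)) ⊆ ω := by
    intro k g
    have h := hk₁ (K + k) (by omega)
    simp only [badEvent, Set.mem_ofPred_eq, not_exists, not_forall, not_not] at h
    exact h g
  choose j hj using hopen
  have hle : ∀ k, 2 ^ k ≤ 2 ^ (K + k) := fun k => Nat.pow_le_pow_right (by norm_num) (by omega)
  -- One fully open edge from each of the first `2 ^ k` of the `2 ^ (K + k)` groups: this gives the
  -- multiplicities required for the half-line started at `K`.
  set idx : ∀ k, Fin (2 ^ k) → Fin (lineMult (K + k)) := fun k g =>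
    groupIndex (Fin.castLE (hle k) g) (j k (Fin.castLE (hle k) g)) with hidx
  have hL : ∀ k g, (openGraph lineGraph ω).Adj (Sum.inl (K + k)) (lineMid (K + k) (idx k g)) :=
    fun k g => ⟨lineGraph_adj_left _ _, hj k _ (Finset.mem_coe.2 (mem_halves.2 (Or.inl rfl)))⟩
  have hR : ∀ k g, (openGraph lineGraph ω).Adj (lineMid (K + k) (idx k g))
      (Sum.inl (K + (k + 1))) :=
    fun k g => ⟨lineGraph_adj_right _ _, hj k _ (Finset.mem_coe.2 (mem_halves.2 (Or.inr rfl)))⟩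
  have hcl : ∀ k g, lineMid (K + k) (idx k g) ∈ cluster lineGraph ω (Sum.inl (K + k)) :=
    fun k g => (hL k g).reachable
  have hcap : CapPos (enlarge ω H).coe ⟨_, subset_enlarge ω H (hmem 0)⟩ := by
    refine capPos_of_multiple_line (X := (enlarge ω H).coe)
      (a := fun k => ⟨Sum.inl (K + k), subset_enlarge ω H (hmem k)⟩)
      (b := fun k g => ⟨lineMid (K + k) (idx k g), mem_enlarge_of_mem_cluster (hmem k) (hcl k g)⟩)
      ?_ ?_ ?_ ?_
    · intro k k' h
      simpa using h
    · intro k g g' h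
      have h1 := (groupIndex_inj (lineMid_injective _ (Subtype.mk.inj h))).1
      exact Fin.castLE_injective (hle k) h1
    · intro k g
      exact Or.inr ⟨_, hmem k, SimpleGraph.Reachable.refl _, hcl k g, hL k g⟩
    · intro k g
      exact Or.inr ⟨_, hmem k, hcl k g, (hcl k g).trans (hR k g).reachable, hR k g⟩
  exact isTransient_of_capPos (lineGraph_locFinite.coe _) (enlarge_connected ω hH) hcap

lemma lineGraph_pc2 {H : lineGraph.Subgraph} (hinf : H.verts.Infinite)
    (hH : H.coe.Connected) : pc2 lineGraph H (transientSubgraphs lineGraph) = 0 := by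
  refine sInf_eq_bot.2 fun b hb => ?_
  obtain ⟨p, hp0, hpb⟩ := exists_between hb
  refine ⟨p, ?_, hpb⟩
  filter_upwards [ae_eventually_notMem_badEvent hp0] with ω hω
  exact enlarge_mem_transientSubgraphs hinf hH hω

lemma lineMult_strictMono : StrictMono lineMult := fun m n h =>
  Nat.mul_lt_mul'' (Nat.pow_lt_pow_right (by norm_num) h) (Nat.pow_lt_pow_right (by norm_num) h)

end PercEnlarge

end

theorem mainTheorem7 :
    (∃ (V : Type) (T : SimpleGraph V) (r : V),
      T.IsTree ∧ PercEnlarge.LocFinite T ∧ PercEnlarge.IsTransient T ∧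
      (∀ v : V, PercEnlarge.pc T v = 1) ∧
      ∃ G : SimpleGraph {q : (ℤ × ℤ) × V // q.1 = (0, 0) ∨ q.2 = r},
        G = PercEnlarge.attach PercEnlarge.squareLattice (0, 0) T r ∧
        PercEnlarge.LocFinite G ∧ PercEnlarge.IsTransient G ∧
        ∀ H : G.Subgraph, PercEnlarge.IsRecurrent H.coe →
          ∀ x, 0 < PercEnlarge.pc G x ∧
            PercEnlarge.pc G x <
              PercEnlarge.pc1 G H (PercEnlarge.transientSubgraphs G) ∧
            PercEnlarge.pc1 G H (PercEnlarge.transientSubgraphs G) = 1) ∧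
    (∃ m : ℕ → ℕ, 0 < m 0 ∧ StrictMono m ∧
      ∃ G : SimpleGraph (ℕ ⊕ (Σ k : ℕ, Fin (m k))),
        G = PercEnlarge.multiLine m ∧
        PercEnlarge.LocFinite G ∧ PercEnlarge.IsTransient G ∧
        ∀ H : G.Subgraph, H.verts.Infinite → PercEnlarge.IsRecurrent H.coe →
          PercEnlarge.pc2 G H (PercEnlarge.transientSubgraphs G) = 0) := by
  open PercEnlarge in
  refine ⟨⟨TreeVertex, polyTree, treeRoot, polyTree_isTree, polyTree_locFinite,
    isTransient_of_capPos polyTree_locFinite polyTree_connected polyTree_capPos, polyTree_pc,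
    glueGraph, rfl, glueGraph_locFinite, glueGraph_isTransient, fun H hH x => ?_⟩,
    ⟨lineMult, by simp, lineMult_strictMono, lineGraph, rfl, lineGraph_locFinite,
      lineGraph_isTransient, fun H hinf hH => lineGraph_pc2 hinf hH.1⟩⟩
  rw [glueGraph_pc1 hH]
  exact ⟨pc_pos (D := 21) glueGraph_degree_le x, glueGraph_pc_lt_one x, rfl⟩
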